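/- **Setting.** Let $X$ be a paracompact Hausdorff space (for instance a smooth manifold), $Y$ a topological space and $\pi:Y\to X$ a continuous locally split map (every $x\in X$ has an open neighbourhood over which $\pi$ has a continuous section). Put $Y^{[p]}=\{(y_1,\dots,y_p):\pi(y_1)=\dots=\pi(y_p)\}$. All bundles and maps are continuous; smooth bundles over manifolds are a special case. A ($U(1)$) *bundle gerbe* $(L,Y)$ over $X$ is a Hermitian complex line bundle $L\to Y^{[2]}$ with an isomorphism of Hermitian line bundles $L_{(y_1,y_2)}\otimes L_{(y_2,y_3)}\cong L_{(y_1,y_3)}$ over $Y^{[3]}$ (the product) that is associative over $Y^{[4]}$. Its *Dixmier–Douady class* $d(L)\in H^3(X,\mathbb Z)$ (Čech cohomology, the direct limit over all open covers) is defined as follows. For a sufficiently fine open cover $\{U_\alpha\}$ choose sections $s_\alpha:U_\alpha\to Y$ of $\pi$, unit sections $\sigma_{\alpha\beta}$ of $(s_\alpha,s_\beta)^{-1}L$ over $U_\alpha\cap U_\beta$, and continuous functions $\rho_{\alpha\beta\gamma}:U_\alpha\cap U_\beta\cap U_\gamma\to\mathbb R$ with $\sigma_{\alpha\beta}\otimes\sigma_{\beta\gamma}=g_{\alpha\beta\gamma}\,\sigma_{\alpha\gamma}$,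 where $g_{\alpha\beta\gamma}=e^{2\pi i\rho_{\alpha\beta\gamma}}$. Then the Čech coboundary $\delta\rho$ is an integral $3$-cocycle, and $d(L)=[\delta\rho]$, the image of $[g]\in H^2(X,\underline{U(1)})$ under the Bockstein homomorphism. Such choices exist and $d(L)$ does not depend on them. A *bundle gerbe module* of rank $n$ for $(L,Y)$ is a complex vector bundle $E\to Y$ of rank $n$ with an isomorphism of vector bundles over $Y^{[2]}$, $L_{(y_1,y_2)}\otimes E_{y_2}\cong E_{y_1}$, compatible with the product: the two resulting maps $L_{(y_1,y_2)}\otimes L_{(y_2,y_3)}\otimes E_{y_3}\to E_{y_1}$ coincide for all $(y_1,y_2,y_3)\in Y^{[3]}$. **Proposition.** If a bundle gerbe $(L,Y)$ over $X$ has a bundle gerbe module $E\to Y$ of finite rank $n$, then $n\,d(L)=0$ in $H^3(X,\mathbb Z)$. -/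

import Mathlib

open Bundle

set_option linter.unusedSectionVars false

universe u v w

/-- An open cover of `X` indexed by the points of `X`, with `x` in the member of index `x`.
Every open cover is refined by one of these, so they are cofinal among all open covers. -/
structure PointedCover (X : Type u) [TopologicalSpace X] where
  set : X → Set X
  isOpen_set : ∀ x, IsOpen (set x)
  mem_set : ∀ x, x ∈ set x

namespace PointedCover

variable {X : Type u} [TopologicalSpace X]

/-- `𝒰 ≤ 𝒱` means that `𝒱` is finer than `𝒰`. -/
instance : Preorder (PointedCover X) where
  le 𝒰 𝒱 := ∀ x, 𝒱.set x ⊆ 𝒰.set x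
  le_refl _ _ := subset_rfl
  le_trans _ _ _ h k x := (k x).trans (h x)

instance : Nonempty (PointedCover X) :=
  ⟨⟨fun _ => Set.univ, fun _ => isOpen_univ, fun _ => Set.mem_univ _⟩⟩

instance : IsDirectedOrder (PointedCover X) where
  directed 𝒰 𝒱 := ⟨⟨fun x => 𝒰.set x ∩ 𝒱.set x,
    fun x => (𝒰.isOpen_set x).inter (𝒱.isOpen_set x), fun x => ⟨𝒰.mem_set x, 𝒱.mem_set x⟩⟩,
    fun _ => Set.inter_subset_left, fun _ => Set.inter_subset_right⟩

/-- The intersection `U_{i 0} ∩ ⋯ ∩ U_{i p}`. -/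
def inter (𝒰 : PointedCover X) {p : ℕ} (i : Fin (p + 1) → X) : Set X := {a | ∀ j, a ∈ 𝒰.set (i j)}

lemma isOpen_inter (𝒰 : PointedCover X) {p : ℕ} (i : Fin (p + 1) → X) : IsOpen (𝒰.inter i) := by
  have : 𝒰.inter i = ⋂ j, 𝒰.set (i j) := by ext; simp [inter]
  rw [this]
  exact isOpen_iInter_of_finite fun j => 𝒰.isOpen_set _

variable (𝒰 : PointedCover X) {𝒱 : PointedCover X} (p : ℕ)
variable (A : Type v) [AddCommGroup A] [TopologicalSpace A] [IsTopologicalAddGroup A]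

/-- Čech `p`-cochains of the cover `𝒰` with values in the sheaf of continuous `A`-valued functions
(the constant sheaf when `A` is discrete). -/
abbrev Cochain : Type (max u v) := ∀ i : Fin (p + 1) → X, C(𝒰.inter i, A)

lemma inter_subset_face {p : ℕ} (i : Fin (p + 2) → X) (j : Fin (p + 2)) :
    𝒰.inter i ⊆ 𝒰.inter (i ∘ j.succAbove) := fun _ ha _ => ha _

/-- The Čech coboundary, the alternating sum over the omitted index. -/
def coboundary : 𝒰.Cochain p A →+ 𝒰.Cochain (p + 1) A where
  toFun α i := ∑ j : Fin (p + 2), (-1 : ℤ) ^ (j : ℕ) •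
    (α (i ∘ j.succAbove)).comp ⟨Set.inclusion (𝒰.inter_subset_face i j), continuous_inclusion _⟩
  map_zero' := by
    ext i a; simp
  map_add' α β := by
    ext i a
    simp [ContinuousMap.add_comp, Finset.sum_add_distrib]

def cocycles : AddSubgroup (𝒰.Cochain p A) := (𝒰.coboundary p A).ker

def coboundaries : (p : ℕ) → AddSubgroup (𝒰.Cochain p A)
  | 0 => ⊥
  | p + 1 => (𝒰.coboundary p A).range

/-- The Čech cohomology group of the cover `𝒰`. -/
abbrev Cohomology : Type (max u v) :=
  𝒰.cocycles p A ⧸ (𝒰.coboundaries A p).addSubgroupOf (𝒰.cocycles p A)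

variable {𝒰}

lemma inter_anti (h : 𝒰 ≤ 𝒱) {p : ℕ} (i : Fin (p + 1) → X) : 𝒱.inter i ⊆ 𝒰.inter i :=
  fun _ ha j => h _ (ha j)

/-- Restriction of cochains to a finer cover. -/
def restrict (h : 𝒰 ≤ 𝒱) : 𝒰.Cochain p A →+ 𝒱.Cochain p A where
  toFun α i := (α i).comp ⟨Set.inclusion (inter_anti h i), continuous_inclusion _⟩
  map_zero' := rfl
  map_add' _ _ := rfl

variable {p A}

lemma coboundary_apply (α : 𝒰.Cochain p A) (i : Fin (p + 2) → X) (a : 𝒰.inter i) :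
    𝒰.coboundary p A α i a = ∑ j : Fin (p + 2), (-1 : ℤ) ^ (j : ℕ) •
      α (i ∘ j.succAbove) ⟨a.1, 𝒰.inter_subset_face i j a.2⟩ := by
  simp [coboundary, Set.inclusion]

lemma restrict_apply (h : 𝒰 ≤ 𝒱) (α : 𝒰.Cochain p A) (i : Fin (p + 1) → X) (a : 𝒱.inter i) :
    restrict p A h α i a = α i ⟨a.1, inter_anti h i a.2⟩ := rfl

lemma coboundary_restrict (h : 𝒰 ≤ 𝒱) (α : 𝒰.Cochain p A) :
    𝒱.coboundary p A (restrict p A h α) = restrict (p + 1) A h (𝒰.coboundary p A α) := by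
  ext i a
  simp only [coboundary_apply, restrict_apply]

variable (p A)

def restrictCocycles (h : 𝒰 ≤ 𝒱) : 𝒰.cocycles p A →+ 𝒱.cocycles p A :=
  ((restrict p A h).comp (𝒰.cocycles p A).subtype).codRestrict _ fun α => by
    have hα : 𝒰.coboundary p A α.1 = 0 := α.2
    change 𝒱.coboundary p A (restrict p A h α.1) = 0
    rw [coboundary_restrict, hα, map_zero]

lemma restrict_mem_coboundaries (h : 𝒰 ≤ 𝒱) (α : 𝒰.Cochain p A)
    (hα : α ∈ 𝒰.coboundaries A p) : restrict p A h α ∈ 𝒱.coboundaries A p := by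
  cases p with
  | zero =>
    simp only [coboundaries, AddSubgroup.mem_bot] at hα ⊢
    rw [hα, map_zero]
  | succ p =>
    obtain ⟨β, rfl⟩ := hα
    exact ⟨restrict p A h β, coboundary_restrict h β⟩

/-- The map induced on cohomology by passing to a finer cover. -/
def restrictCohomology (h : 𝒰 ≤ 𝒱) : 𝒰.Cohomology p A →+ 𝒱.Cohomology p A :=
  QuotientAddGroup.map _ _ (restrictCocycles p A h) fun α hα =>
    restrict_mem_coboundaries p A h α.1 hα

end PointedCover

section
variable (X : Type u) [TopologicalSpace X] (p : ℕ)
variable (A : Type v) [AddCommGroup A] [TopologicalSpace A] [IsTopologicalAddGroup A]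

open Classical in
/-- The Čech cohomology group `Ȟ^p(X, A)` of `X` with values in the sheaf of continuous `A`-valued
functions: the direct limit, over all open covers, of the Čech cohomology of the covers. -/
def CechCohomology : Type (max u v) :=
  AddCommGroup.DirectLimit (fun 𝒰 : PointedCover X => 𝒰.Cohomology p A)
    (fun _ _ h => PointedCover.restrictCohomology p A h)

open Classical in
noncomputable instance : AddCommGroup (CechCohomology X p A) :=
  inferInstanceAs (AddCommGroup (AddCommGroup.DirectLimit
    (fun 𝒰 : PointedCover X => 𝒰.Cohomology p A)
    (fun _ _ h => PointedCover.restrictCohomology p A h)))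

variable {X p A}
open Classical in
/-- The class in `Ȟ^p(X, A)` of a Čech cocycle of a cover. -/
noncomputable def PointedCover.cohomologyClass (𝒰 : PointedCover X) :
    𝒰.cocycles p A →+ CechCohomology X p A :=
  (AddCommGroup.DirectLimit.of (fun 𝒰 : PointedCover X => 𝒰.Cohomology p A)
    (fun _ _ h => PointedCover.restrictCohomology p A h) 𝒰).comp (QuotientAddGroup.mk' _)

end

section Gerbe

variable {X : Type u} {Y : Type v} [TopologicalSpace X] [TopologicalSpace Y]

/-- The fibre product `Y^[2]`. -/
abbrev FibreSquare (pr : Y → X) : Type v := {q : Y × Y // pr q.1 = pr q.2}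

/-- The fibre product `Y^[3]`. -/
abbrev FibreCube (pr : Y → X) : Type v :=
  {q : Y × Y × Y // pr q.1 = pr q.2.1 ∧ pr q.2.1 = pr q.2.2}

namespace FibreCube

variable {pr : Y → X}

def pair₁₂ (q : FibreCube pr) : FibreSquare pr := ⟨(q.1.1, q.1.2.1), q.2.1⟩
def pair₂₃ (q : FibreCube pr) : FibreSquare pr := ⟨(q.1.2.1, q.1.2.2), q.2.2⟩
def pair₁₃ (q : FibreCube pr) : FibreSquare pr := ⟨(q.1.1, q.1.2.2), q.2.1.trans q.2.2⟩

end FibreCube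

/-- A continuous map with continuous local sections near each point of its target. -/
structure IsLocallySplit (pr : Y → X) : Prop where
  continuous : Continuous pr
  exists_section : ∀ x : X, ∃ U : Set X, IsOpen U ∧ x ∈ U ∧ ∃ s : C(U, Y), ∀ a, pr (s a) = a

/-- A Hermitian metric on a complex line bundle, given by the norm that it defines on the fibres
(on a one-dimensional space the norm determines the inner product, and any norm arises). -/
structure HermitianLineMetric {B : Type v} [TopologicalSpace B] (L : B → Type w)
    [∀ b, AddCommGroup (L b)] [∀ b, Module ℂ (L b)] [TopologicalSpace (TotalSpace ℂ L)] where
  norm : ∀ b, L b → ℝ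
  norm_smul : ∀ b (c : ℂ) (l : L b), norm b (c • l) = ‖c‖ * norm b l
  norm_pos : ∀ b (l : L b), l ≠ 0 → 0 < norm b l
  continuous_norm : Continuous fun z : TotalSpace ℂ L => norm z.proj z.snd

/-- A (`U(1)`) bundle gerbe `(L, Y, X)`: a locally split map `pr : Y → X` and a Hermitian line
bundle `L → Y^[2]` with an associative product, an isomorphism
`L_(y₁,y₂) ⊗ L_(y₂,y₃) ≅ L_(y₁,y₃)` of Hermitian line bundles over `Y^[3]`.
The isomorphism is given by the bilinear map `(l, m) ↦ mul (l ⊗ m)`; its continuity is that of this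
bilinear map on the fibrewise product of the two bundles. -/
structure BundleGerbe (pr : Y → X) (L : FibreSquare pr → Type w)
    [∀ q, AddCommGroup (L q)] [∀ q, Module ℂ (L q)] [∀ q, TopologicalSpace (L q)]
    [TopologicalSpace (TotalSpace ℂ L)] [FiberBundle ℂ L] [VectorBundle ℂ ℂ L] where
  isLocallySplit : IsLocallySplit pr
  metric : HermitianLineMetric L
  mul : ∀ q : FibreCube pr, L q.pair₁₂ →ₗ[ℂ] L q.pair₂₃ →ₗ[ℂ] L q.pair₁₃
  bijective_mul : ∀ q, Function.Bijective (TensorProduct.lift (mul q))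
  continuous_mul : Continuous fun z : TotalSpace (ℂ × ℂ)
      ((FibreCube.pair₁₂ *ᵖ L) ×ᵇ (FibreCube.pair₂₃ *ᵖ L)) =>
    TotalSpace.mk' ℂ (E := L) z.proj.pair₁₃ (mul z.proj z.snd.1 z.snd.2)
  norm_mul : ∀ q l m, metric.norm _ (mul q l m) = metric.norm _ l * metric.norm _ m
  mul_assoc : ∀ (y₁ y₂ y₃ y₄ : Y) (h₁₂ : pr y₁ = pr y₂) (h₂₃ : pr y₂ = pr y₃) (h₃₄ : pr y₃ = pr y₄)
    (k : L ⟨(y₁, y₂), h₁₂⟩) (l : L ⟨(y₂, y₃), h₂₃⟩) (m : L ⟨(y₃, y₄), h₃₄⟩),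
    mul ⟨(y₁, y₃, y₄), h₁₂.trans h₂₃, h₃₄⟩ (mul ⟨(y₁, y₂, y₃), h₁₂, h₂₃⟩ k l) m =
      mul ⟨(y₁, y₂, y₄), h₁₂, h₂₃.trans h₃₄⟩ k (mul ⟨(y₂, y₃, y₄), h₂₃, h₃₄⟩ l m)

namespace BundleGerbe

variable {pr : Y → X} {L : FibreSquare pr → Type w}
  [∀ q, AddCommGroup (L q)] [∀ q, Module ℂ (L q)] [∀ q, TopologicalSpace (L q)]
  [TopologicalSpace (TotalSpace ℂ L)] [FiberBundle ℂ L] [VectorBundle ℂ ℂ L]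

/-- Continuous sections `s_x : U_x → Y` of `pr` over the members of an open cover `U_x` of `X`, and
continuous unit sections `σ_xy` of `L_xy = (s_x, s_y)⁻¹ L` over `U_x ∩ U_y`. -/
structure LocalSections (𝒢 : BundleGerbe pr L) (𝒰 : PointedCover X) where
  sec : ∀ x, C(𝒰.set x, Y)
  proj_sec : ∀ x a, pr (sec x a) = a
  triv : ∀ (x y a : X) (hx : a ∈ 𝒰.set x) (hy : a ∈ 𝒰.set y),
    L ⟨(sec x ⟨a, hx⟩, sec y ⟨a, hy⟩), (proj_sec x ⟨a, hx⟩).trans (proj_sec y ⟨a, hy⟩).symm⟩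
  continuous_triv : ∀ x y, Continuous fun a : ↥(𝒰.set x ∩ 𝒰.set y) =>
    TotalSpace.mk' ℂ (E := L) _ (triv x y a a.2.1 a.2.2)
  norm_triv : ∀ x y a hx hy, 𝒢.metric.norm _ (triv x y a hx hy) = 1

/-- `σ_xy ⊗ σ_yz`, as an element of `L_xz`, at the point `a` of `U_x ∩ U_y ∩ U_z`. -/
def LocalSections.mulTriv {𝒢 : BundleGerbe pr L} {𝒰 : PointedCover X} (D : 𝒢.LocalSections 𝒰)
    (x y z a : X) (hx : a ∈ 𝒰.set x) (hy : a ∈ 𝒰.set y) (hz : a ∈ 𝒰.set z) :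
    L ⟨(D.sec x ⟨a, hx⟩, D.sec z ⟨a, hz⟩),
      (D.proj_sec x ⟨a, hx⟩).trans (D.proj_sec z ⟨a, hz⟩).symm⟩ :=
  𝒢.mul ⟨(D.sec x ⟨a, hx⟩, D.sec y ⟨a, hy⟩, D.sec z ⟨a, hz⟩),
      (D.proj_sec x ⟨a, hx⟩).trans (D.proj_sec y ⟨a, hy⟩).symm,
      (D.proj_sec y ⟨a, hy⟩).trans (D.proj_sec z ⟨a, hz⟩).symm⟩
    (D.triv x y a hx hy) (D.triv y z a hy hz)

/-- The choices from which the Dixmier–Douady class of a bundle gerbe is computed over an open cover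
`U_x`: sections `s_x` and `σ_xy` as above, and continuous `ρ_xyz : U_x ∩ U_y ∩ U_z → ℝ` such that
`σ_xy ⊗ σ_yz = g_xyz σ_xz` with `g_xyz = exp (2π i ρ_xyz)`. -/
structure LocalData (𝒢 : BundleGerbe pr L) (𝒰 : PointedCover X) extends 𝒢.LocalSections 𝒰 where
  phase : 𝒰.Cochain 2 ℝ
  mul_triv : ∀ (i : Fin 3 → X) (a : 𝒰.inter i),
    toLocalSections.mulTriv (i 0) (i 1) (i 2) a (a.2 0) (a.2 1) (a.2 2) =
      Complex.exp (2 * Real.pi * Complex.I * phase i a) • triv (i 0) (i 2) a (a.2 0) (a.2 2)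

/-- `d` is the Dixmier–Douady class of the bundle gerbe, i.e. the image of the class of the cocycle
`g = exp (2π i ρ)` under the Bockstein homomorphism of `0 → ℤ → ℝ → U(1) → 0`: it is the class of
the integral cocycle `δρ`, for some choice of a cover, of sections and of `ρ`. -/
def IsDixmierDouadyClass (𝒢 : BundleGerbe pr L) (d : CechCohomology X 3 ℤ) : Prop :=
  ∃ (𝒰 : PointedCover X) (D : 𝒢.LocalData 𝒰) (ν : 𝒰.cocycles 3 ℤ),
    (∀ (i : Fin 4 → X) (a : 𝒰.inter i), (ν.1 i a : ℝ) = 𝒰.coboundary 2 ℝ D.phase i a) ∧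
      d = 𝒰.cohomologyClass ν

end BundleGerbe

/-- A bundle gerbe module structure on a complex vector bundle `E → Y`: an isomorphism
`L_(y₁,y₂) ⊗ E_(y₂) ≅ E_(y₁)` of vector bundles over `Y^[2]`, compatible with the product of the
bundle gerbe. It is given by the bilinear map `(l, e) ↦ act (l ⊗ e)`. -/
structure BundleGerbeModule {pr : Y → X} {L : FibreSquare pr → Type w}
    [∀ q, AddCommGroup (L q)] [∀ q, Module ℂ (L q)] [∀ q, TopologicalSpace (L q)]
    [TopologicalSpace (TotalSpace ℂ L)] [FiberBundle ℂ L] [VectorBundle ℂ ℂ L]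
    (𝒢 : BundleGerbe pr L) (n : ℕ) (E : Y → Type*)
    [∀ y, AddCommGroup (E y)] [∀ y, Module ℂ (E y)] [∀ y, TopologicalSpace (E y)]
    [TopologicalSpace (TotalSpace (EuclideanSpace ℂ (Fin n)) E)]
    [FiberBundle (EuclideanSpace ℂ (Fin n)) E]
    [VectorBundle ℂ (EuclideanSpace ℂ (Fin n)) E] where
  act : ∀ q : FibreSquare pr, L q →ₗ[ℂ] E q.1.2 →ₗ[ℂ] E q.1.1
  bijective_act : ∀ q, Function.Bijective (TensorProduct.lift (act q))
  continuous_act : Continuous fun z : TotalSpace (ℂ × EuclideanSpace ℂ (Fin n))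
      (L ×ᵇ ((fun q : FibreSquare pr => q.1.2) *ᵖ E)) =>
    TotalSpace.mk' (EuclideanSpace ℂ (Fin n)) (E := E) z.proj.1.1 (act z.proj z.snd.1 z.snd.2)
  mul_act : ∀ (y₁ y₂ y₃ : Y) (h₁₂ : pr y₁ = pr y₂) (h₂₃ : pr y₂ = pr y₃)
    (k : L ⟨(y₁, y₂), h₁₂⟩) (l : L ⟨(y₂, y₃), h₂₃⟩) (e : E y₃),
    act ⟨(y₁, y₃), h₁₂.trans h₂₃⟩ (𝒢.mul ⟨(y₁, y₂, y₃), h₁₂, h₂₃⟩ k l) e =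
      act ⟨(y₁, y₂), h₁₂⟩ k (act ⟨(y₂, y₃), h₂₃⟩ l e)

end Gerbe

section Existence

open Topology

theorem PointedCover.exists_refinement {X : Type u} [TopologicalSpace X] [T2Space X]
    [ParacompactSpace X] (𝒱 : PointedCover X) (P : X → X → X → Set X → Prop)
    (hmono : ∀ x y z W W', W' ⊆ W → P x y z W → P x y z W')
    (hempty : ∀ x y z, P x y z ∅)
    (hloc : ∀ x y z a, a ∈ 𝒱.set x → a ∈ 𝒱.set y → a ∈ 𝒱.set z → ∃ W ∈ 𝓝 a, P x y z W) :
    ∃ (𝒲 : PointedCover X) (r : X → X), (∀ a, 𝒲.set a ⊆ 𝒱.set (r a)) ∧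
      ∀ a b c, P (r a) (r b) (r c) (𝒲.set a ∩ 𝒲.set b ∩ 𝒲.set c) := by
  obtain ⟨v, vo, vc, vlf, vV⟩ := precise_refinement 𝒱.set 𝒱.isOpen_set
    (Set.iUnion_eq_univ_iff.2 fun x => ⟨x, 𝒱.mem_set x⟩)
  obtain ⟨w, wc, wo, wv⟩ := exists_iUnion_eq_closure_subset vo (fun x => vlf.point_finite x) vc
  choose r hr using fun a => Set.mem_iUnion.1 (wc.symm ▸ Set.mem_univ a : a ∈ ⋃ i, w i)
  have wlf : LocallyFinite fun i => closure (w i) := vlf.subset wv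
  have key : ∀ a, ∃ W : Set X, IsOpen W ∧ a ∈ W ∧ W ⊆ w (r a) ∧
      (∀ i, (W ∩ w i).Nonempty → a ∈ v i) ∧
      ∀ i j, a ∈ v i → a ∈ v j → P (r a) i j W := by
    intro a
    have hfin := vlf.point_finite a
    choose N hN hP using hloc
    have hra : a ∈ v (r a) := wv _ (subset_closure (hr a))
    have h1 := wlf.iInter_compl_mem_nhds (fun i => isClosed_closure) a
    have h2 : (⋂ i ∈ {i | a ∈ v i}, ⋂ j ∈ {i | a ∈ v i},
        {b | ∀ (hi : a ∈ v i) (hj : a ∈ v j),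
          b ∈ N (r a) i j a (vV _ hra) (vV _ hi) (vV _ hj)}) ∈ 𝓝 a := by
      refine (Filter.biInter_mem hfin).2 fun i hi => (Filter.biInter_mem hfin).2 fun j hj => ?_
      exact Filter.mem_of_superset (hN (r a) i j a (vV _ hra) (vV _ hi) (vV _ hj))
        fun b hb _ _ => hb
    have h3 := Filter.inter_mem (Filter.inter_mem h1 h2) ((wo (r a)).mem_nhds (hr a))
    obtain ⟨W, hW, Wo, aW⟩ := mem_nhds_iff.1 h3
    refine ⟨W, Wo, aW, fun b hb => (hW hb).2, ?_, ?_⟩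
    · rintro i ⟨b, hb, hbi⟩
      by_contra hai
      have := (hW hb).1.1
      simp only [Set.mem_iInter] at this
      exact this i (fun h => hai (wv i h)) (subset_closure hbi)
    · intro i j hi hj
      refine hmono _ _ _ _ _ ?_ (hP (r a) i j a (vV _ hra) (vV _ hi) (vV _ hj))
      intro b hb
      have := (hW hb).1.2
      simp only [Set.mem_iInter] at this
      exact this i hi j hj hi hj
  choose W Wo aW Ww W1 W2 using key
  refine ⟨⟨W, Wo, aW⟩, r, fun a => (Ww a).trans ((subset_closure.trans (wv _)).trans (vV _)), ?_⟩
  intro a b c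
  rcases Set.eq_empty_or_nonempty (W a ∩ W b ∩ W c) with h | ⟨x, ⟨hxa, hxb⟩, hxc⟩
  · change P _ _ _ (W a ∩ W b ∩ W c)
    rw [h]; exact hempty _ _ _
  · refine hmono _ _ _ (W a) _ (fun y hy => hy.1.1) (W2 a _ _ ?_ ?_)
    · exact W1 a _ ⟨x, hxa, Ww b hxb⟩
    · exact W1 a _ ⟨x, hxa, Ww c hxc⟩

section LineBundle

variable {B : Type v} [TopologicalSpace B] {L : B → Type w}
  [∀ b, AddCommGroup (L b)] [∀ b, Module ℂ (L b)] [∀ b, TopologicalSpace (L b)]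
  [TopologicalSpace (TotalSpace ℂ L)] [FiberBundle ℂ L] [VectorBundle ℂ ℂ L]

lemma LineBundle.exists_eq_smul (b : B) (l m : L b) (hm : m ≠ 0) : ∃ c : ℂ, l = c • m := by
  let e := (trivializationAt ℂ L b).continuousLinearEquivAt ℂ b
    (FiberBundle.mem_baseSet_trivializationAt ℂ L b)
  have : e m ≠ 0 := by simpa using hm
  refine ⟨e l / e m, e.injective ?_⟩
  rw [map_smul, smul_eq_mul, div_mul_cancel₀ _ this]

lemma LineBundle.continuous_of_smul {T : Type*} [TopologicalSpace T] (q : T → B)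
    (l m : ∀ t, L (q t)) (c : T → ℂ) (hm : ∀ t, m t ≠ 0) (h : ∀ t, l t = c t • m t)
    (hl : Continuous fun t => TotalSpace.mk' ℂ (q t) (l t))
    (hm' : Continuous fun t => TotalSpace.mk' ℂ (q t) (m t)) : Continuous c := by
  rw [continuous_iff_continuousAt]
  intro t₀
  have h1 := (FiberBundle.continuousAt_totalSpace ℂ _).1 (hl.continuousAt (x := t₀))
  have h2 := (FiberBundle.continuousAt_totalSpace ℂ _).1 (hm'.continuousAt (x := t₀))
  set e := trivializationAt ℂ L (q t₀) with he
  have hb : ∀ᶠ t in 𝓝 t₀, q t ∈ e.baseSet :=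
    h1.1 (e.open_baseSet.mem_nhds (FiberBundle.mem_baseSet_trivializationAt ℂ L _))
  have hne : ∀ t, q t ∈ e.baseSet → (e ⟨q t, m t⟩).2 ≠ 0 := by
    intro t ht h0
    apply hm t
    have := (e.continuousLinearEquivAt ℂ (q t) ht).injective (a₁ := m t) (a₂ := 0)
    apply this
    rw [map_zero]
    exact h0
  refine (h1.2.div h2.2 (hne t₀ hb.self_of_nhds)).congr ?_
  filter_upwards [hb] with t ht
  have := (e.linear ℂ ht).map_smul (c t) (m t)
  change (e ⟨q t, l t⟩).2 / (e ⟨q t, m t⟩).2 = c t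
  rw [h t, this, smul_eq_mul, mul_div_cancel_right₀ _ (hne t ht)]

lemma HermitianLineMetric.ne_zero (μ : HermitianLineMetric L) {b : B} {l : L b}
    (h : μ.norm b l = 1) : l ≠ 0 := by
  rintro rfl
  have := μ.norm_smul b 0 0
  simp only [smul_zero, norm_zero, zero_mul, h] at this
  exact one_ne_zero this

lemma HermitianLineMetric.exists_section (μ : HermitianLineMetric L) {T : Type*}
    [TopologicalSpace T] (q : T → B) (hq : Continuous q) (t₀ : T) :
    ∃ W ∈ 𝓝 t₀, ∃ l : ∀ t, L (q t), (∀ t ∈ W, μ.norm _ (l t) = 1) ∧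
      ContinuousOn (fun t => TotalSpace.mk' ℂ (q t) (l t)) W := by
  classical
  let e := trivializationAt ℂ L (q t₀)
  have hW : q ⁻¹' e.baseSet ∈ 𝓝 t₀ := hq.continuousAt
    (e.open_baseSet.mem_nhds (FiberBundle.mem_baseSet_trivializationAt ℂ L _))
  let m : ∀ t, L (q t) := fun t => e.symm (q t) 1
  have hmk : ∀ (c : T → ℂ), ContinuousOn c (q ⁻¹' e.baseSet) →
      ContinuousOn (fun t => TotalSpace.mk' ℂ (q t) (c t • m t)) (q ⁻¹' e.baseSet) := by
    intro c hc
    have h1 : ContinuousOn (fun t => e.toOpenPartialHomeomorph.symm (q t, c t))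
        (q ⁻¹' e.baseSet) :=
      e.toOpenPartialHomeomorph.continuousOn_symm.comp (hq.continuousOn.prodMk hc)
        fun t ht => by rw [e.target_eq]; exact ⟨ht, Set.mem_univ _⟩
    refine h1.congr fun t ht => ?_
    refine Eq.trans ?_ (e.mk_symm ht (c t))
    have : e.symm (q t) (c t) = c t • m t := by
      have := (e.symmₗ ℂ (q t)).map_smul (c t) 1
      rwa [smul_eq_mul, mul_one, e.coe_symmₗ ht] at this
    rw [this]
  have hm : ContinuousOn (fun t => TotalSpace.mk' ℂ (q t) (m t)) (q ⁻¹' e.baseSet) := by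
    simpa using hmk (fun _ => 1) continuousOn_const
  have hm0 : ∀ t ∈ q ⁻¹' e.baseSet, m t ≠ 0 := by
    intro t ht h0
    have h1 := e.apply_mk_symm ht (1 : ℂ)
    have h2 := (e.linear ℂ ht).map_zero
    change e ⟨q t, m t⟩ = _ at h1
    rw [h0] at h1
    change (e ⟨q t, 0⟩).2 = 0 at h2
    rw [h1] at h2
    exact one_ne_zero h2
  have hn : ContinuousOn (fun t => μ.norm _ (m t)) (q ⁻¹' e.baseSet) :=
    μ.continuous_norm.comp_continuousOn hm
  refine ⟨_, hW, fun t => (((μ.norm _ (m t))⁻¹ : ℝ) : ℂ) • m t, ?_, ?_⟩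
  · intro t ht
    have := μ.norm_pos _ _ (hm0 t ht)
    rw [μ.norm_smul, Complex.norm_real, norm_inv, Real.norm_of_nonneg this.le,
      inv_mul_cancel₀ this.ne']
  · apply hmk
    exact Complex.continuous_ofReal.comp_continuousOn
      (hn.inv₀ fun t ht => (μ.norm_pos _ _ (hm0 t ht)).ne')

end LineBundle

namespace BundleGerbe

variable {X : Type u} {Y : Type v} [TopologicalSpace X] [TopologicalSpace Y]
variable {pr : Y → X} {L : FibreSquare pr → Type w}
  [∀ q, AddCommGroup (L q)] [∀ q, Module ℂ (L q)] [∀ q, TopologicalSpace (L q)]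
  [TopologicalSpace (TotalSpace ℂ L)] [FiberBundle ℂ L] [VectorBundle ℂ ℂ L]
variable {𝒢 : BundleGerbe pr L} {𝒰 𝒱 : PointedCover X}

lemma norm_zero (𝒢 : BundleGerbe pr L) (q) : 𝒢.metric.norm q 0 = 0 := by
  simpa using 𝒢.metric.norm_smul q 0 0

/-- Sections over a cover give sections over every refinement. -/
def LocalSections.pullback (D : 𝒢.LocalSections 𝒰) (r : X → X)
    (h : ∀ a, 𝒱.set a ⊆ 𝒰.set (r a)) : 𝒢.LocalSections 𝒱 where
  sec x := (D.sec (r x)).comp ⟨Set.inclusion (h x), continuous_inclusion _⟩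
  proj_sec _ _ := D.proj_sec _ _
  triv x y a hx hy := D.triv (r x) (r y) a (h x hx) (h y hy)
  continuous_triv x y := (D.continuous_triv (r x) (r y)).comp
    (continuous_inclusion (Set.inter_subset_inter (h x) (h y)))
  norm_triv _ _ _ _ _ := D.norm_triv _ _ _ _ _

lemma continuous_mul_sections (𝒢 : BundleGerbe pr L) {T : Type*} [TopologicalSpace T]
    (y₁ y₂ y₃ : T → Y) (h₁ : Continuous y₁) (h₂ : Continuous y₂) (h₃ : Continuous y₃)
    (h₁₂ : ∀ t, pr (y₁ t) = pr (y₂ t)) (h₂₃ : ∀ t, pr (y₂ t) = pr (y₃ t))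
    (l : ∀ t, L ⟨(y₁ t, y₂ t), h₁₂ t⟩) (m : ∀ t, L ⟨(y₂ t, y₃ t), h₂₃ t⟩)
    (hl : Continuous fun t => TotalSpace.mk' ℂ (E := L) _ (l t))
    (hm : Continuous fun t => TotalSpace.mk' ℂ (E := L) _ (m t)) :
    Continuous fun t => TotalSpace.mk' ℂ (E := L) _
      (𝒢.mul ⟨(y₁ t, y₂ t, y₃ t), h₁₂ t, h₂₃ t⟩ (l t) (m t)) := by
  let q : T → FibreCube pr := fun t => ⟨(y₁ t, y₂ t, y₃ t), h₁₂ t, h₂₃ t⟩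
  have hq : Continuous q := by fun_prop
  have key : Continuous fun t => (TotalSpace.mk' (ℂ × ℂ)
      (E := (FibreCube.pair₁₂ *ᵖ L) ×ᵇ (FibreCube.pair₂₃ *ᵖ L)) (q t) (l t, m t)) := by
    rw [(FiberBundle.Prod.isInducing_diag ℂ _ ℂ _).continuous_iff]
    refine Continuous.prodMk ?_ ?_
    · rw [(inducing_pullbackTotalSpaceEmbedding ℂ L _).continuous_iff]
      exact hq.prodMk hl
    · rw [(inducing_pullbackTotalSpaceEmbedding ℂ L _).continuous_iff]
      exact hq.prodMk hm
  exact 𝒢.continuous_mul.comp key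

lemma LocalSections.continuous_triv_comp (D : 𝒢.LocalSections 𝒰) {p : ℕ} (i : Fin (p + 1) → X)
    (j k : Fin (p + 1)) : Continuous fun a : 𝒰.inter i =>
      TotalSpace.mk' ℂ (E := L) _ (D.triv (i j) (i k) a (a.2 j) (a.2 k)) :=
  (D.continuous_triv (i j) (i k)).comp (f := fun a : 𝒰.inter i =>
    (⟨a.1, a.2 j, a.2 k⟩ : ↥(𝒰.set (i j) ∩ 𝒰.set (i k)))) (by fun_prop)

lemma LocalSections.norm_mulTriv (D : 𝒢.LocalSections 𝒰) (x y z a : X) (hx hy hz) :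
    𝒢.metric.norm _ (D.mulTriv x y z a hx hy hz) = 1 := by
  have := 𝒢.norm_mul ⟨(D.sec x ⟨a, hx⟩, D.sec y ⟨a, hy⟩, D.sec z ⟨a, hz⟩),
      (D.proj_sec x ⟨a, hx⟩).trans (D.proj_sec y ⟨a, hy⟩).symm,
      (D.proj_sec y ⟨a, hy⟩).trans (D.proj_sec z ⟨a, hz⟩).symm⟩
    (D.triv x y a hx hy) (D.triv y z a hy hz)
  refine this.trans ?_
  erw [D.norm_triv, D.norm_triv, one_mul]

lemma LocalSections.exists_ratio (D : 𝒢.LocalSections 𝒰) :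
    ∃ g : 𝒰.Cochain 2 ℂ, (∀ i a, ‖g i a‖ = 1) ∧ ∀ (i : Fin 3 → X) (a : 𝒰.inter i),
      D.mulTriv (i 0) (i 1) (i 2) a (a.2 0) (a.2 1) (a.2 2) =
        g i a • D.triv (i 0) (i 2) a (a.2 0) (a.2 2) := by
  have hne : ∀ x y a hx hy, D.triv x y a hx hy ≠ 0 := fun x y a hx hy =>
    𝒢.metric.ne_zero (D.norm_triv x y a hx hy)
  choose c hc using fun (i : Fin 3 → X) (a : 𝒰.inter i) => LineBundle.exists_eq_smul _
    (D.mulTriv (i 0) (i 1) (i 2) a (a.2 0) (a.2 1) (a.2 2)) _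
    (hne (i 0) (i 2) a (a.2 0) (a.2 2))
  refine ⟨fun i => ⟨c i, ?_⟩, fun i a => ?_, hc⟩
  · refine LineBundle.continuous_of_smul (L := L)
      (fun a : 𝒰.inter i => ⟨(D.sec (i 0) ⟨a, a.2 0⟩, D.sec (i 2) ⟨a, a.2 2⟩), _⟩)
      _ _ _ (fun a => hne (i 0) (i 2) a (a.2 0) (a.2 2)) (hc i) ?_ ?_
    · refine 𝒢.continuous_mul_sections
        (fun a : 𝒰.inter i => D.sec (i 0) ⟨a, a.2 0⟩) (fun a => D.sec (i 1) ⟨a, a.2 1⟩)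
        (fun a => D.sec (i 2) ⟨a, a.2 2⟩) (by fun_prop) (by fun_prop) (by fun_prop) _ _ _ _ ?_ ?_
      · exact D.continuous_triv_comp i 0 1
      · exact D.continuous_triv_comp i 1 2
    · exact D.continuous_triv_comp i 0 2
  · have h := congrArg (𝒢.metric.norm _) (hc i a)
    rw [𝒢.metric.norm_smul, D.norm_triv, mul_one, D.norm_mulTriv] at h
    exact h.symm

theorem exists_localSections [T2Space X] [ParacompactSpace X] (𝒢 : BundleGerbe pr L) :
    ∃ 𝒰 : PointedCover X, Nonempty (𝒢.LocalSections 𝒰) := by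
  choose U Uo xU s hs using 𝒢.isLocallySplit.exists_section
  let 𝒱 : PointedCover X := ⟨U, Uo, xU⟩
  obtain ⟨𝒲, r, hr, hP⟩ := 𝒱.exists_refinement (fun x y _ W =>
    ∃ l : ∀ (a : X) (hx : a ∈ U x) (hy : a ∈ U y),
      L ⟨(s x ⟨a, hx⟩, s y ⟨a, hy⟩), (hs x ⟨a, hx⟩).trans (hs y ⟨a, hy⟩).symm⟩,
      (Continuous fun a : ↥(W ∩ (U x ∩ U y)) =>
        TotalSpace.mk' ℂ (E := L) _ (l a a.2.2.1 a.2.2.2)) ∧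
      ∀ a ∈ W, ∀ hx hy, 𝒢.metric.norm _ (l a hx hy) = 1)
    (by
      rintro x y - W W' hW ⟨l, hl, hn⟩
      exact ⟨l, hl.comp (continuous_inclusion (Set.inter_subset_inter_left _ hW)),
        fun a ha => hn a (hW ha)⟩)
    (by
      intro x y _
      refine ⟨fun a hx hy => 0, ?_, fun a ha => ha.elim⟩
      rw [continuous_iff_continuousAt]
      exact fun a => a.2.1.elim)
    (by
      intro x y _ a hx hy _
      obtain ⟨W, hW, l, hn, hc⟩ := 𝒢.metric.exists_section
        (fun b : ↥(U x ∩ U y) => (⟨(s x ⟨b, b.2.1⟩, s y ⟨b, b.2.2⟩),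
          (hs x ⟨b, b.2.1⟩).trans (hs y ⟨b, b.2.2⟩).symm⟩ : FibreSquare pr)) (by fun_prop)
        ⟨a, hx, hy⟩
      refine ⟨Subtype.val '' W, (((Uo x).inter (Uo y)).isOpenMap_subtype_val).image_mem_nhds hW,
        fun b hx hy => l ⟨b, hx, hy⟩, ?_, ?_⟩
      · refine hc.comp_continuous (f := fun a : ↥(Subtype.val '' W ∩ (U x ∩ U y)) =>
          (⟨a, a.2.2⟩ : ↥(U x ∩ U y))) (by fun_prop) ?_
        rintro ⟨_, ⟨b, hb, rfl⟩, h⟩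
        exact hb
      · rintro _ ⟨b, hb, rfl⟩ hx hy
        exact hn b hb)
  choose l hl hn using hP
  refine ⟨𝒲, ⟨⟨fun x => (s (r x)).comp ⟨Set.inclusion (hr x), continuous_inclusion _⟩,
    fun x a => hs _ _, fun x y a hx hy => l x y x a (hr x hx) (hr y hy), fun x y => ?_,
    fun x y a hx hy => hn x y x a ⟨⟨hx, hy⟩, hx⟩ _ _⟩⟩⟩
  exact (hl x y x).comp (f := fun a : ↥(𝒲.set x ∩ 𝒲.set y) =>
    (⟨a.1, ⟨a.2, a.2.1⟩, hr x a.2.1, hr y a.2.2⟩ :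
      ↥((𝒲.set x ∩ 𝒲.set y ∩ 𝒲.set x) ∩ (U (r x) ∩ U (r y))))) (by fun_prop)

lemma exists_log {T : Type*} [TopologicalSpace T] (g : T → ℂ) (hg : Continuous g)
    (h1 : ∀ t, ‖g t‖ = 1) (t₀ : T) : ∃ W ∈ 𝓝 t₀, ∃ ρ : T → ℝ, ContinuousOn ρ W ∧
      ∀ t, g t = Complex.exp (2 * Real.pi * Complex.I * ρ t) := by
  have h0 : ∀ t, g t ≠ 0 := fun t h => by simpa [h] using h1 t
  have hexp : ∀ z : ℂ, ‖z‖ = 1 → z = Complex.exp (z.arg * Complex.I) := fun z hz => by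
    simpa [hz] using (Complex.norm_mul_exp_arg_mul_I z).symm
  have hd : ContinuousAt (fun t => g t / g t₀) t₀ := hg.continuousAt.div_const _
  refine ⟨{t | g t / g t₀ ∈ Complex.slitPlane}, hd (Complex.isOpen_slitPlane.mem_nhds
    (by simp [div_self (h0 t₀)])), fun t => ((g t / g t₀).arg + (g t₀).arg) / (2 * Real.pi),
    ?_, ?_⟩
  · intro t ht
    refine ((((Complex.continuousAt_arg ht).comp (f := fun t => g t / g t₀)
      (hg.continuousAt.div_const _)).add continuousAt_const).div_const _).continuousWithinAt
  · intro t
    have hpi : (Real.pi : ℂ) ≠ 0 := by exact_mod_cast Real.pi_ne_zero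
    have e1 := hexp (g t / g t₀) (by rw [norm_div, h1, h1, div_one])
    have e2 := hexp (g t₀) (h1 _)
    have : 2 * (Real.pi : ℂ) * Complex.I *
        ((((g t / g t₀).arg + (g t₀).arg) / (2 * Real.pi) : ℝ) : ℂ) =
        (g t / g t₀).arg * Complex.I + (g t₀).arg * Complex.I := by
      push_cast; field_simp
    rw [this, Complex.exp_add, ← e1, ← e2, div_mul_cancel₀ _ (h0 _)]

theorem exists_phase [T2Space X] [ParacompactSpace X] (g : 𝒰.Cochain 2 ℂ)
    (hg : ∀ i a, ‖g i a‖ = 1) : ∃ (𝒱 : PointedCover X) (r : X → X)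
      (h : ∀ a, 𝒱.set a ⊆ 𝒰.set (r a)) (ρ : 𝒱.Cochain 2 ℝ), ∀ i a,
      g (r ∘ i) ⟨a.1, fun j => h _ (a.2 j)⟩ = Complex.exp (2 * Real.pi * Complex.I * ρ i a) := by
  obtain ⟨𝒲, r, hr, hP⟩ := 𝒰.exists_refinement (fun x y z W =>
    ∃ ρ : 𝒰.inter (p := 2) ![x, y, z] → ℝ, ContinuousOn ρ {a | a.1 ∈ W} ∧
      ∀ a, a.1 ∈ W → g _ a = Complex.exp (2 * Real.pi * Complex.I * ρ a))
    (by
      rintro x y z W W' hW ⟨ρ, hρ, h⟩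
      exact ⟨ρ, hρ.mono fun a ha => hW ha, fun a ha => h a (hW ha)⟩)
    (by
      exact fun x y z => ⟨0, continuousOn_const, fun a ha => ha.elim⟩)
    (by
      intro x y z a hx hy hz
      have ha : a ∈ 𝒰.inter (p := 2) ![x, y, z] := by
        intro j; fin_cases j; exacts [hx, hy, hz]
      obtain ⟨W, hW, ρ, hρ, h⟩ := exists_log (g ![x, y, z]) (g _).continuous (hg _) ⟨a, ha⟩
      refine ⟨Subtype.val '' W, ((𝒰.isOpen_inter _).isOpenMap_subtype_val).image_mem_nhds hW, ρ, ?_,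
        fun b _ => h b⟩
      refine hρ.mono ?_
      rintro b ⟨c, hc, hcb⟩
      rwa [← Subtype.ext hcb])
  have hP' : ∀ i : Fin 3 → X, ∃ ρ : 𝒰.inter (r ∘ i) → ℝ,
      ContinuousOn ρ {a | a.1 ∈ 𝒲.set (i 0) ∩ 𝒲.set (i 1) ∩ 𝒲.set (i 2)} ∧
      ∀ a, a.1 ∈ 𝒲.set (i 0) ∩ 𝒲.set (i 1) ∩ 𝒲.set (i 2) →
        g _ a = Complex.exp (2 * Real.pi * Complex.I * ρ a) := by
    intro i
    have hi : r ∘ i = ![r (i 0), r (i 1), r (i 2)] := by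
      ext j; fin_cases j <;> rfl
    rw [hi]
    exact hP _ _ _
  choose ρ hρ h using hP'
  refine ⟨𝒲, r, hr, fun i => ⟨fun a => ρ i ⟨a.1, fun j => hr _ (a.2 j)⟩, ?_⟩, ?_⟩
  · exact (hρ i).comp_continuous (f := fun a : 𝒲.inter i =>
      (⟨a.1, fun j => hr _ (a.2 j)⟩ : 𝒰.inter (r ∘ i))) (by fun_prop)
      fun a => ⟨⟨a.2 0, a.2 1⟩, a.2 2⟩
  · exact fun i a => h i _ ⟨⟨a.2 0, a.2 1⟩, a.2 2⟩

theorem exists_localData [T2Space X] [ParacompactSpace X] (𝒢 : BundleGerbe pr L) :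
    ∃ 𝒰 : PointedCover X, Nonempty (𝒢.LocalData 𝒰) := by
  obtain ⟨𝒰, ⟨D⟩⟩ := 𝒢.exists_localSections
  obtain ⟨g, hg, hD⟩ := D.exists_ratio
  obtain ⟨𝒱, r, hr, ρ, hρ⟩ := exists_phase g hg
  refine ⟨𝒱, ⟨⟨D.pullback r hr, ρ, fun i a => ?_⟩⟩⟩
  rw [← hρ]
  exact hD (r ∘ i) ⟨a.1, fun j => hr _ (a.2 j)⟩

end BundleGerbe

namespace PointedCover

variable {X : Type u} [TopologicalSpace X] {𝒰 𝒱 : PointedCover X} {p : ℕ}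
variable {A : Type v} [AddCommGroup A] [TopologicalSpace A] [IsTopologicalAddGroup A]

open Classical in
/-- The value of a cochain at a point, extended by zero. -/
noncomputable def eval (α : 𝒰.Cochain p A) (i : Fin (p + 1) → X) (a : X) : A :=
  if h : a ∈ 𝒰.inter i then α i ⟨a, h⟩ else 0

lemma eval_of_mem (α : 𝒰.Cochain p A) (i : Fin (p + 1) → X) (a : X) (h : a ∈ 𝒰.inter i) :
    eval α i a = α i ⟨a, h⟩ := dif_pos h

lemma coboundary_eval (α : 𝒰.Cochain p A) (i : Fin (p + 2) → X) (a : 𝒰.inter i) :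
    𝒰.coboundary p A α i a = ∑ j : Fin (p + 2), (-1 : ℤ) ^ (j : ℕ) •
      eval α (i ∘ j.succAbove) a := by
  rw [coboundary_apply]
  refine Finset.sum_congr rfl fun j _ => ?_
  rw [eval_of_mem _ _ _ (𝒰.inter_subset_face i j a.2)]

lemma coboundary_one (α : 𝒰.Cochain 1 A) (i : Fin 3 → X) (a : X) (ha : a ∈ 𝒰.inter (p := 2) i) :
    eval (𝒰.coboundary 1 A α) i a = eval α ![i 1, i 2] a - eval α ![i 0, i 2] a +
      eval α ![i 0, i 1] a := by
  have h0 : i ∘ (0 : Fin 3).succAbove = ![i 1, i 2] := by ext j; fin_cases j <;> rfl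
  have h1 : i ∘ (1 : Fin 3).succAbove = ![i 0, i 2] := by ext j; fin_cases j <;> rfl
  have h2 : i ∘ (2 : Fin 3).succAbove = ![i 0, i 1] := by ext j; fin_cases j <;> rfl
  rw [eval_of_mem _ _ _ ha, coboundary_eval]
  simp only [Nat.reduceAdd, Fin.sum_univ_three, h0, h1, h2]
  simp [sub_eq_add_neg]

lemma coboundary_two (α : 𝒰.Cochain 2 A) (i : Fin 4 → X) (a : X)
    (ha : a ∈ 𝒰.inter (p := 3) i) :
    eval (𝒰.coboundary 2 A α) i a = eval α ![i 1, i 2, i 3] a - eval α ![i 0, i 2, i 3] a +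
      eval α ![i 0, i 1, i 3] a - eval α ![i 0, i 1, i 2] a := by
  have h0 : i ∘ (0 : Fin 4).succAbove = ![i 1, i 2, i 3] := by ext j; fin_cases j <;> rfl
  have h1 : i ∘ (1 : Fin 4).succAbove = ![i 0, i 2, i 3] := by ext j; fin_cases j <;> rfl
  have h2 : i ∘ (2 : Fin 4).succAbove = ![i 0, i 1, i 3] := by ext j; fin_cases j <;> rfl
  have h3 : i ∘ (3 : Fin 4).succAbove = ![i 0, i 1, i 2] := by ext j; fin_cases j <;> rfl
  rw [eval_of_mem _ _ _ ha, coboundary_eval]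
  simp only [Nat.reduceAdd, Fin.sum_univ_four, h0, h1, h2, h3]
  simp [sub_eq_add_neg, pow_succ]

lemma coboundary_three (α : 𝒰.Cochain 3 A) (i : Fin 5 → X) (a : X)
    (ha : a ∈ 𝒰.inter (p := 4) i) :
    eval (𝒰.coboundary 3 A α) i a = eval α ![i 1, i 2, i 3, i 4] a -
      eval α ![i 0, i 2, i 3, i 4] a + eval α ![i 0, i 1, i 3, i 4] a -
      eval α ![i 0, i 1, i 2, i 4] a + eval α ![i 0, i 1, i 2, i 3] a := by
  have h0 : i ∘ (0 : Fin 5).succAbove = ![i 1, i 2, i 3, i 4] := by ext j; fin_cases j <;> rfl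
  have h1 : i ∘ (1 : Fin 5).succAbove = ![i 0, i 2, i 3, i 4] := by ext j; fin_cases j <;> rfl
  have h2 : i ∘ (2 : Fin 5).succAbove = ![i 0, i 1, i 3, i 4] := by ext j; fin_cases j <;> rfl
  have h3 : i ∘ (3 : Fin 5).succAbove = ![i 0, i 1, i 2, i 4] := by ext j; fin_cases j <;> rfl
  have h4 : i ∘ (4 : Fin 5).succAbove = ![i 0, i 1, i 2, i 3] := by ext j; fin_cases j <;> rfl
  rw [eval_of_mem _ _ _ ha, coboundary_eval]
  simp only [Nat.reduceAdd, Fin.sum_univ_five, h0, h1, h2, h3, h4]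
  simp [sub_eq_add_neg, pow_succ]

lemma mem_inter_of_forall (i : Fin (p + 1) → X) (a : X) (h : ∀ j, a ∈ 𝒰.set (i j)) :
    a ∈ 𝒰.inter i := h

lemma mem₂ {x y a : X} (hx : a ∈ 𝒰.set x) (hy : a ∈ 𝒰.set y) :
    a ∈ 𝒰.inter (p := 1) ![x, y] := by
  intro j; fin_cases j; exacts [hx, hy]

lemma mem₃ {x y z a : X} (hx : a ∈ 𝒰.set x) (hy : a ∈ 𝒰.set y) (hz : a ∈ 𝒰.set z) :
    a ∈ 𝒰.inter (p := 2) ![x, y, z] := by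
  intro j; fin_cases j; exacts [hx, hy, hz]

lemma mem₄ {x y z w a : X} (hx : a ∈ 𝒰.set x) (hy : a ∈ 𝒰.set y) (hz : a ∈ 𝒰.set z)
    (hw : a ∈ 𝒰.set w) : a ∈ 𝒰.inter (p := 3) ![x, y, z, w] := by
  intro j; fin_cases j; exacts [hx, hy, hz, hw]

lemma mem₅ {x y z w v a : X} (hx : a ∈ 𝒰.set x) (hy : a ∈ 𝒰.set y) (hz : a ∈ 𝒰.set z)
    (hw : a ∈ 𝒰.set w) (hv : a ∈ 𝒰.set v) : a ∈ 𝒰.inter (p := 4) ![x, y, z, w, v] := by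
  intro j; fin_cases j; exacts [hx, hy, hz, hw, hv]

lemma coboundary_coboundary_one (α : 𝒰.Cochain 1 A) :
    𝒰.coboundary 2 A (𝒰.coboundary 1 A α) = 0 := by
  ext i ⟨a, ha⟩
  have := coboundary_two (𝒰.coboundary 1 A α) i a ha
  rw [eval_of_mem _ _ _ ha] at this
  rw [this, coboundary_one, coboundary_one, coboundary_one, coboundary_one]
  · simp only [Matrix.cons_val]
    simp only [Pi.zero_apply, ContinuousMap.zero_apply]
    abel
  all_goals exact mem₃ (ha _) (ha _) (ha _)

lemma coboundary_coboundary_two (α : 𝒰.Cochain 2 A) :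
    𝒰.coboundary 3 A (𝒰.coboundary 2 A α) = 0 := by
  ext i ⟨a, ha⟩
  have := coboundary_three (𝒰.coboundary 2 A α) i a ha
  rw [eval_of_mem _ _ _ ha] at this
  rw [this, coboundary_two, coboundary_two, coboundary_two, coboundary_two, coboundary_two]
  · simp only [Matrix.cons_val]
    simp only [Pi.zero_apply, ContinuousMap.zero_apply]
    abel
  all_goals exact mem₄ (ha _) (ha _) (ha _) (ha _)

lemma coboundary_intCast (k : 𝒰.Cochain p ℤ) (α : 𝒰.Cochain p ℝ)
    (h : ∀ i a, (k i a : ℝ) = α i a) (i : Fin (p + 2) → X) (a : 𝒰.inter i) :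
    (𝒰.coboundary p ℤ k i a : ℝ) = 𝒰.coboundary p ℝ α i a := by
  rw [coboundary_apply, coboundary_apply]
  push_cast
  refine Finset.sum_congr rfl fun j _ => ?_
  rw [← h]
  simp

lemma exists_int (α : 𝒰.Cochain p ℝ)
    (h : ∀ i a, Complex.exp (2 * Real.pi * Complex.I * α i a) = 1) :
    ∃ k : 𝒰.Cochain p ℤ, ∀ i a, (k i a : ℝ) = α i a := by
  have : ∀ i a, ∃ n : ℤ, (n : ℝ) = α i a := by
    intro i a
    obtain ⟨n, hn⟩ := Complex.exp_eq_one_iff.1 (h i a)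
    refine ⟨n, ?_⟩
    have h2 : (2 * Real.pi * Complex.I : ℂ) ≠ 0 := Complex.two_pi_I_ne_zero
    rw [mul_comm (n : ℂ)] at hn
    exact_mod_cast (mul_left_cancel₀ h2 hn).symm
  choose n hn using this
  refine ⟨fun i => ⟨n i, ?_⟩, hn⟩
  rw [Int.isClosedEmbedding_coe_real.isInducing.continuous_iff]
  exact (α i).continuous.congr fun a => (hn i a).symm

/-- Pulling back cochains along a refinement that may change the indices. -/
def pull (r : X → X) (h : ∀ a, 𝒱.set a ⊆ 𝒰.set (r a)) (α : 𝒰.Cochain p A) : 𝒱.Cochain p A :=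
  fun i => (α (r ∘ i)).comp ⟨fun a => ⟨a.1, fun j => h _ (a.2 j)⟩, by fun_prop⟩

lemma coboundary_pull (r : X → X) (h : ∀ a, 𝒱.set a ⊆ 𝒰.set (r a)) (α : 𝒰.Cochain p A) :
    𝒱.coboundary p A (pull r h α) = pull r h (𝒰.coboundary p A α) := by
  ext i a
  change _ = 𝒰.coboundary p A α (r ∘ i) ⟨a.1, _⟩
  simp only [coboundary_apply]
  rfl

lemma pull_mem (r : X → X) (h : ∀ a, 𝒱.set a ⊆ 𝒰.set (r a)) {α : 𝒰.Cochain p A}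
    (hα : α ∈ 𝒰.cocycles p A) : pull r h α ∈ 𝒱.cocycles p A := by
  change 𝒱.coboundary p A (pull r h α) = 0
  rw [coboundary_pull, show 𝒰.coboundary p A α = 0 from hα]
  rfl

lemma eval_pull (r : X → X) (h : ∀ a, 𝒱.set a ⊆ 𝒰.set (r a)) (α : 𝒰.Cochain p A)
    (i : Fin (p + 1) → X) (a : X) (ha : a ∈ 𝒱.inter i) :
    eval (pull r h α) i a = eval α (r ∘ i) a := by
  rw [eval_of_mem _ _ _ ha, eval_of_mem α (r ∘ i) a (fun j => h _ (ha j))]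
  rfl

lemma cohomologyClass_restrict (h : 𝒰 ≤ 𝒱) (α : 𝒰.cocycles p A) :
    𝒱.cohomologyClass (restrictCocycles p A h α) = 𝒰.cohomologyClass α := by
  classical
  exact AddCommGroup.DirectLimit.of_f (G := fun 𝒰 : PointedCover X => 𝒰.Cohomology p A)
    (f := fun _ _ h => PointedCover.restrictCohomology p A h) h
    (QuotientAddGroup.mk' _ α)

lemma cohomologyClass_eq {α β : 𝒰.cocycles (p + 1) A} (γ : 𝒰.Cochain p A)
    (h : α.1 - β.1 = 𝒰.coboundary p A γ) : 𝒰.cohomologyClass α = 𝒰.cohomologyClass β := by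
  rw [← sub_eq_zero, ← map_sub]
  have : (QuotientAddGroup.mk' ((𝒰.coboundaries A (p + 1)).addSubgroupOf
      (𝒰.cocycles (p + 1) A))) (α - β) = 0 := by
    rw [QuotientAddGroup.mk'_apply, QuotientAddGroup.eq_zero_iff]
    exact ⟨γ, h.symm⟩
  classical
  exact (congrArg (AddCommGroup.DirectLimit.of
    (fun 𝒰 : PointedCover X => 𝒰.Cohomology (p + 1) A)
    (fun _ _ h => PointedCover.restrictCohomology (p + 1) A h) 𝒰) this).trans (map_zero _)

lemma cohomologyClass_pull_eq (r s : X → X) (hr : ∀ a, 𝒱.set a ⊆ 𝒰.set (r a))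
    (hs : ∀ a, 𝒱.set a ⊆ 𝒰.set (s a)) (α : 𝒰.cocycles 3 A) :
    𝒱.cohomologyClass ⟨pull r hr α.1, pull_mem r hr α.2⟩ =
      𝒱.cohomologyClass ⟨pull s hs α.1, pull_mem s hs α.2⟩ := by
  have m1 : ∀ (i : Fin 3 → X) (a : 𝒱.inter (p := 2) i),
      a.1 ∈ 𝒰.inter (p := 3) ![r (i 0), s (i 0), s (i 1), s (i 2)] := fun i a =>
    mem₄ (hr _ (a.2 0)) (hs _ (a.2 0)) (hs _ (a.2 1)) (hs _ (a.2 2))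
  have m2 : ∀ (i : Fin 3 → X) (a : 𝒱.inter (p := 2) i),
      a.1 ∈ 𝒰.inter (p := 3) ![r (i 0), r (i 1), s (i 1), s (i 2)] := fun i a =>
    mem₄ (hr _ (a.2 0)) (hr _ (a.2 1)) (hs _ (a.2 1)) (hs _ (a.2 2))
  have m3 : ∀ (i : Fin 3 → X) (a : 𝒱.inter (p := 2) i),
      a.1 ∈ 𝒰.inter (p := 3) ![r (i 0), r (i 1), r (i 2), s (i 2)] := fun i a =>
    mem₄ (hr _ (a.2 0)) (hr _ (a.2 1)) (hr _ (a.2 2)) (hs _ (a.2 2))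
  let γ : 𝒱.Cochain 2 A := fun i =>
    -((α.1 _).comp ⟨fun a => ⟨a.1, m1 i a⟩, by fun_prop⟩) +
    (α.1 _).comp ⟨fun a => ⟨a.1, m2 i a⟩, by fun_prop⟩ -
    (α.1 _).comp ⟨fun a => ⟨a.1, m3 i a⟩, by fun_prop⟩
  have hγ : ∀ (i : Fin 3 → X) (a : X), a ∈ 𝒱.inter (p := 2) i → eval γ i a =
      -eval α.1 ![r (i 0), s (i 0), s (i 1), s (i 2)] a +
      eval α.1 ![r (i 0), r (i 1), s (i 1), s (i 2)] a -
      eval α.1 ![r (i 0), r (i 1), r (i 2), s (i 2)] a := by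
    intro i a ha
    rw [eval_of_mem _ _ _ ha, eval_of_mem _ _ _ (m1 i ⟨a, ha⟩), eval_of_mem _ _ _ (m2 i ⟨a, ha⟩),
      eval_of_mem _ _ _ (m3 i ⟨a, ha⟩)]
    rfl
  refine cohomologyClass_eq γ ?_
  ext i ⟨a, ha⟩
  have hα : ∀ (k : Fin 5 → X), a ∈ 𝒰.inter (p := 4) k → eval (𝒰.coboundary 3 A α.1) k a = 0 := by
    intro k hk
    rw [eval_of_mem _ _ _ hk, show 𝒰.coboundary 3 A α.1 = 0 from α.2]
    rfl
  have e1 := hα ![r (i 0), s (i 0), s (i 1), s (i 2), s (i 3)]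
    (mem₅ (hr _ (ha _)) (hs _ (ha _)) (hs _ (ha _)) (hs _ (ha _)) (hs _ (ha _)))
  have e2 := hα ![r (i 0), r (i 1), s (i 1), s (i 2), s (i 3)]
    (mem₅ (hr _ (ha _)) (hr _ (ha _)) (hs _ (ha _)) (hs _ (ha _)) (hs _ (ha _)))
  have e3 := hα ![r (i 0), r (i 1), r (i 2), s (i 2), s (i 3)]
    (mem₅ (hr _ (ha _)) (hr _ (ha _)) (hr _ (ha _)) (hs _ (ha _)) (hs _ (ha _)))
  have e4 := hα ![r (i 0), r (i 1), r (i 2), r (i 3), s (i 3)]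
    (mem₅ (hr _ (ha _)) (hr _ (ha _)) (hr _ (ha _)) (hr _ (ha _)) (hs _ (ha _)))
  rw [coboundary_three] at e1 e2 e3 e4
  rotate_left
  · exact mem₅ (hr _ (ha _)) (hr _ (ha _)) (hr _ (ha _)) (hr _ (ha _)) (hs _ (ha _))
  · exact mem₅ (hr _ (ha _)) (hr _ (ha _)) (hr _ (ha _)) (hs _ (ha _)) (hs _ (ha _))
  · exact mem₅ (hr _ (ha _)) (hr _ (ha _)) (hs _ (ha _)) (hs _ (ha _)) (hs _ (ha _))
  · exact mem₅ (hr _ (ha _)) (hs _ (ha _)) (hs _ (ha _)) (hs _ (ha _)) (hs _ (ha _))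
  have h1 := coboundary_two γ i a ha
  rw [eval_of_mem _ _ _ ha, hγ _ _ (mem₃ (ha _) (ha _) (ha _)), hγ _ _ (mem₃ (ha _) (ha _) (ha _)),
    hγ _ _ (mem₃ (ha _) (ha _) (ha _)), hγ _ _ (mem₃ (ha _) (ha _) (ha _))] at h1
  have hri : r ∘ i = ![r (i 0), r (i 1), r (i 2), r (i 3)] := by ext j; fin_cases j <;> rfl
  have hsi : s ∘ i = ![s (i 0), s (i 1), s (i 2), s (i 3)] := by ext j; fin_cases j <;> rfl
  have h2 := eval_pull r hr α.1 i a ha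
  have h3 := eval_pull s hs α.1 i a ha
  rw [eval_of_mem _ _ _ ha, hri] at h2
  rw [eval_of_mem _ _ _ ha, hsi] at h3
  change pull r hr α.1 i ⟨a, ha⟩ - pull s hs α.1 i ⟨a, ha⟩ = _
  rw [h1, h2, h3]
  simp only [Matrix.cons_val] at e1 e2 e3 e4 ⊢
  have := congrArg₂ (· + ·) (congrArg₂ (· - ·) e2 e1) (congrArg₂ (· - ·) e4 e3)
  simp only [sub_self, add_zero] at this
  rw [← sub_eq_zero, ← this]
  abel

/-- A refinement does not change the class of a cocycle, whatever the map on indices. -/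
lemma cohomologyClass_pull (r : X → X) (hr : ∀ a, 𝒱.set a ⊆ 𝒰.set (r a)) (α : 𝒰.cocycles 3 A) :
    𝒱.cohomologyClass ⟨pull r hr α.1, pull_mem r hr α.2⟩ = 𝒰.cohomologyClass α := by
  obtain ⟨𝒲, h1, h2⟩ := exists_ge_ge 𝒰 𝒱
  rw [← cohomologyClass_restrict h1 α, ← cohomologyClass_restrict h2]
  exact cohomologyClass_pull_eq (𝒱 := 𝒲) r id (fun a => (h2 a).trans (hr a)) h1 α

end PointedCover

namespace BundleGerbe

variable {X : Type u} {Y : Type v} [TopologicalSpace X] [TopologicalSpace Y]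
variable {pr : Y → X} {L : FibreSquare pr → Type w}
  [∀ q, AddCommGroup (L q)] [∀ q, Module ℂ (L q)] [∀ q, TopologicalSpace (L q)]
  [TopologicalSpace (TotalSpace ℂ L)] [FiberBundle ℂ L] [VectorBundle ℂ ℂ L]
variable {𝒢 : BundleGerbe pr L} {𝒰 𝒱 : PointedCover X}

open PointedCover

lemma LocalSections.triv_ne_zero (D : 𝒢.LocalSections 𝒰) (x y a hx hy) :
    D.triv x y a hx hy ≠ 0 := 𝒢.metric.ne_zero (D.norm_triv x y a hx hy)

/-- Local data over a cover give local data over every refinement. -/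
def LocalData.pullback (D : 𝒢.LocalData 𝒰) (r : X → X)
    (h : ∀ a, 𝒱.set a ⊆ 𝒰.set (r a)) : 𝒢.LocalData 𝒱 where
  toLocalSections := D.toLocalSections.pullback r h
  phase := pull r h D.phase
  mul_triv i a := D.mul_triv (r ∘ i) ⟨a, fun j => h _ (a.2 j)⟩

lemma LocalData.mulTriv_eq (D : 𝒢.LocalData 𝒰) (x y z a : X) (hx : a ∈ 𝒰.set x)
    (hy : a ∈ 𝒰.set y) (hz : a ∈ 𝒰.set z) : D.mulTriv x y z a hx hy hz =
      Complex.exp (2 * Real.pi * Complex.I * eval D.phase ![x, y, z] a) • D.triv x z a hx hz := by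
  rw [eval_of_mem _ _ _ (mem₃ hx hy hz)]
  exact D.mul_triv ![x, y, z] ⟨a, mem₃ hx hy hz⟩

lemma mul_smul_left (𝒢 : BundleGerbe pr L) (q : FibreCube pr) (c : ℂ) (l l' : L q.pair₁₂)
    (m : L q.pair₂₃) (h : l = c • l') : 𝒢.mul q l m = c • 𝒢.mul q l' m := by
  rw [h, map_smul, LinearMap.smul_apply]

lemma mul_smul_right (𝒢 : BundleGerbe pr L) (q : FibreCube pr) (c : ℂ) (l : L q.pair₁₂)
    (m m' : L q.pair₂₃) (h : m = c • m') : 𝒢.mul q l m = c • 𝒢.mul q l m' := by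
  rw [h, map_smul]

/-- If `k l = c₁ u`, `u m = c₂ t`, `l m = c₃ v`, `k v = c₄ t` and `t ≠ 0`, then
`c₁ c₂ = c₃ c₄`. -/
lemma coeff_assoc (𝒢 : BundleGerbe pr L) {y₁ y₂ y₃ y₄ : Y} (h₁₂ : pr y₁ = pr y₂)
    (h₂₃ : pr y₂ = pr y₃) (h₃₄ : pr y₃ = pr y₄) (k : L ⟨(y₁, y₂), h₁₂⟩) (l : L ⟨(y₂, y₃), h₂₃⟩)
    (m : L ⟨(y₃, y₄), h₃₄⟩) (u : L ⟨(y₁, y₃), h₁₂.trans h₂₃⟩) (v : L ⟨(y₂, y₄), h₂₃.trans h₃₄⟩)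
    (t : L ⟨(y₁, y₄), h₁₂.trans (h₂₃.trans h₃₄)⟩) (ht : t ≠ 0) (c₁ c₂ c₃ c₄ : ℂ)
    (e₁ : 𝒢.mul ⟨(y₁, y₂, y₃), h₁₂, h₂₃⟩ k l = c₁ • u)
    (e₂ : 𝒢.mul ⟨(y₁, y₃, y₄), h₁₂.trans h₂₃, h₃₄⟩ u m = c₂ • t)
    (e₃ : 𝒢.mul ⟨(y₂, y₃, y₄), h₂₃, h₃₄⟩ l m = c₃ • v)
    (e₄ : 𝒢.mul ⟨(y₁, y₂, y₄), h₁₂, h₂₃.trans h₃₄⟩ k v = c₄ • t) : c₁ * c₂ = c₃ * c₄ := by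
  have e1 := 𝒢.mul_smul_left ⟨(y₁, y₃, y₄), h₁₂.trans h₂₃, h₃₄⟩ c₁ _ u m e₁
  have e2 := 𝒢.mul_smul_right ⟨(y₁, y₂, y₄), h₁₂, h₂₃.trans h₃₄⟩ c₃ k _ v e₃
  have e := (e1.symm.trans (𝒢.mul_assoc _ _ _ _ h₁₂ h₂₃ h₃₄ k l m)).trans e2
  have e' : c₁ • c₂ • t = c₃ • c₄ • t :=
    ((congrArg (c₁ • ·) e₂).symm.trans e).trans (congrArg (c₃ • ·) e₄)
  rw [smul_smul, smul_smul] at e'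
  by_contra hne
  have h0 : (c₁ * c₂ - c₃ * c₄) • t = 0 := by rw [sub_smul, e', sub_self]
  rcases smul_eq_zero.1 h0 with h | h
  · exact hne (sub_eq_zero.1 h)
  · exact ht h

lemma LocalData.exp_coboundary (D : 𝒢.LocalData 𝒰) (i : Fin 4 → X) (a : 𝒰.inter (p := 3) i) :
    Complex.exp (2 * Real.pi * Complex.I * (𝒰.coboundary 2 ℝ D.phase i a : ℝ)) = 1 := by
  obtain ⟨a, ha⟩ := a
  have h := coboundary_two D.phase i a ha
  rw [eval_of_mem _ _ _ ha] at h
  rw [h]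
  have key := 𝒢.coeff_assoc _ _ _ _ _ _ _ _ _ (D.triv_ne_zero (i 0) (i 3) a (ha 0) (ha 3)) _ _ _ _
    (D.mulTriv_eq (i 0) (i 1) (i 2) a (ha 0) (ha 1) (ha 2))
    (D.mulTriv_eq (i 0) (i 2) (i 3) a (ha 0) (ha 2) (ha 3))
    (D.mulTriv_eq (i 1) (i 2) (i 3) a (ha 1) (ha 2) (ha 3))
    (D.mulTriv_eq (i 0) (i 1) (i 3) a (ha 0) (ha 1) (ha 3))
  simp only [← Complex.exp_add] at key
  push_cast
  rw [show (2 * Real.pi * Complex.I : ℂ) * (eval D.phase ![i 1, i 2, i 3] a -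
      eval D.phase ![i 0, i 2, i 3] a + eval D.phase ![i 0, i 1, i 3] a -
      eval D.phase ![i 0, i 1, i 2] a) =
      (2 * Real.pi * Complex.I * eval D.phase ![i 1, i 2, i 3] a +
        2 * Real.pi * Complex.I * eval D.phase ![i 0, i 1, i 3] a) -
      (2 * Real.pi * Complex.I * eval D.phase ![i 0, i 1, i 2] a +
        2 * Real.pi * Complex.I * eval D.phase ![i 0, i 2, i 3] a) by ring,
    Complex.exp_sub, ← key, div_self (Complex.exp_ne_zero _)]

lemma LocalData.exists_cocycle (D : 𝒢.LocalData 𝒰) : ∃ ν : 𝒰.cocycles 3 ℤ,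
    ∀ (i : Fin 4 → X) (a : 𝒰.inter i), (ν.1 i a : ℝ) = 𝒰.coboundary 2 ℝ D.phase i a := by
  obtain ⟨k, hk⟩ := exists_int (𝒰.coboundary 2 ℝ D.phase) D.exp_coboundary
  refine ⟨⟨k, ?_⟩, hk⟩
  change 𝒰.coboundary 3 ℤ k = 0
  ext i a
  have := coboundary_intCast k _ hk i a
  rw [coboundary_coboundary_two] at this
  exact Int.cast_injective (α := ℝ) (this.trans (by simp))

theorem exists_isDixmierDouadyClass [T2Space X] [ParacompactSpace X] (𝒢 : BundleGerbe pr L) :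
    ∃ d, 𝒢.IsDixmierDouadyClass d := by
  obtain ⟨𝒰, ⟨D⟩⟩ := 𝒢.exists_localData
  obtain ⟨ν, hν⟩ := D.exists_cocycle
  exact ⟨_, 𝒰, D, ν, hν, rfl⟩

/-- The sections of two choices of local data are compared by unit sections `τ_x` of
`(s_x, s'_x)⁻¹ L`, after shrinking the cover. -/
lemma exists_comparison (D D' : 𝒢.LocalSections 𝒰) :
    ∃ (𝒱 : PointedCover X) (h : 𝒰 ≤ 𝒱) (τ : ∀ (x a : X) (hx : a ∈ 𝒱.set x),
      L ⟨(D.sec x ⟨a, h x hx⟩, D'.sec x ⟨a, h x hx⟩),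
        (D.proj_sec x ⟨a, h x hx⟩).trans (D'.proj_sec x ⟨a, h x hx⟩).symm⟩),
      (∀ x, Continuous fun a : 𝒱.set x => TotalSpace.mk' ℂ (E := L) _ (τ x a a.2)) ∧
      ∀ x a hx, 𝒢.metric.norm _ (τ x a hx) = 1 := by
  have : ∀ x, ∃ W : Set X, IsOpen W ∧ x ∈ W ∧ ∃ h : W ⊆ 𝒰.set x, ∃ τ : ∀ (a : X) (hx : a ∈ W),
      L ⟨(D.sec x ⟨a, h hx⟩, D'.sec x ⟨a, h hx⟩),
        (D.proj_sec x ⟨a, h hx⟩).trans (D'.proj_sec x ⟨a, h hx⟩).symm⟩,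
      (Continuous fun a : W => TotalSpace.mk' ℂ (E := L) _ (τ a a.2)) ∧
      ∀ a hx, 𝒢.metric.norm _ (τ a hx) = 1 := by
    intro x
    obtain ⟨W, hW, l, hn, hc⟩ := 𝒢.metric.exists_section
      (fun b : 𝒰.set x => (⟨(D.sec x b, D'.sec x b),
        (D.proj_sec x b).trans (D'.proj_sec x b).symm⟩ : FibreSquare pr)) (by fun_prop)
      ⟨x, 𝒰.mem_set x⟩
    obtain ⟨V, hV, Vo, xV⟩ := mem_nhds_iff.1 hW
    refine ⟨Subtype.val '' V, (𝒰.isOpen_set x).isOpenMap_subtype_val _ Vo, ⟨_, xV, rfl⟩,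
      by rintro _ ⟨b, -, rfl⟩; exact b.2, fun a ha => l ⟨a, _⟩, ?_, ?_⟩
    · refine hc.comp_continuous (f := fun a : ↥(Subtype.val '' V) =>
        (⟨a, by obtain ⟨_, b, -, rfl⟩ := a; exact b.2⟩ : 𝒰.set x)) (by fun_prop) ?_
      rintro ⟨_, ⟨b, hb, rfl⟩⟩
      exact hV hb
    · rintro _ ⟨b, hb, rfl⟩
      exact hn b (hV hb)
  choose W Wo xW h τ hτ hn using this
  exact ⟨⟨W, Wo, xW⟩, h, τ, hτ, hn⟩

/-- Comparison of the multipliers of two families of sections: here `x, y, z` and `x', y', z'` are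
points of one fibre, `σ, σ'` are the sections and `τ` compares them. -/
lemma coeff_comparison (𝒢 : BundleGerbe pr L) {x y z x' y' z' : Y} (hxy : pr x = pr y)
    (hyz : pr y = pr z) (hx : pr x = pr x') (hy : pr y = pr y') (hz : pr z = pr z')
    (hxy' : pr x' = pr y') (hyz' : pr y' = pr z')
    (σxy : L ⟨(x, y), hxy⟩) (σyz : L ⟨(y, z), hyz⟩) (σxz : L ⟨(x, z), hxy.trans hyz⟩)
    (σxy' : L ⟨(x', y'), hxy'⟩) (σyz' : L ⟨(y', z'), hyz'⟩)
    (σxz' : L ⟨(x', z'), hxy'.trans hyz'⟩)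
    (τx : L ⟨(x, x'), hx⟩) (τy : L ⟨(y, y'), hy⟩) (τz : L ⟨(z, z'), hz⟩)
    (g g' fxy fyz fxz : ℂ)
    (hne : 𝒢.mul ⟨(x, x', z'), hx, hxy'.trans hyz'⟩ τx σxz' ≠ 0)
    (e : 𝒢.mul ⟨(x, y, z), hxy, hyz⟩ σxy σyz = g • σxz)
    (e' : 𝒢.mul ⟨(x', y', z'), hxy', hyz'⟩ σxy' σyz' = g' • σxz')
    (exy : 𝒢.mul ⟨(x, y, y'), hxy, hy⟩ σxy τy = fxy • 𝒢.mul ⟨(x, x', y'), hx, hxy'⟩ τx σxy')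
    (eyz : 𝒢.mul ⟨(y, z, z'), hyz, hz⟩ σyz τz = fyz • 𝒢.mul ⟨(y, y', z'), hy, hyz'⟩ τy σyz')
    (exz : 𝒢.mul ⟨(x, z, z'), hxy.trans hyz, hz⟩ σxz τz =
      fxz • 𝒢.mul ⟨(x, x', z'), hx, hxy'.trans hyz'⟩ τx σxz') :
    g * fxz = fyz * (fxy * g') := by
  have a1 := 𝒢.mul_smul_left ⟨(x, z, z'), hxy.trans hyz, hz⟩ g _ _ τz e
  have a2 := a1.trans (congrArg (g • ·) exz)
  have b1 := 𝒢.mul_smul_right ⟨(x, y, z'), hxy, hyz.trans hz⟩ fyz σxy _ _ eyz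
  have b2 := 𝒢.mul_smul_left ⟨(x, y', z'), hxy.trans hy, hyz'⟩ fxy _ _ σyz' exy
  have b3 := 𝒢.mul_smul_right ⟨(x, x', z'), hx, hxy'.trans hyz'⟩ g' τx _ _ e'
  have c1 := 𝒢.mul_assoc _ _ _ _ hxy hyz hz σxy σyz τz
  have c2 := 𝒢.mul_assoc _ _ _ _ hxy hy hyz' σxy τy σyz'
  have c3 := 𝒢.mul_assoc _ _ _ _ hx hxy' hyz' τx σxy' σyz'
  have d := (((a2.symm.trans c1).trans b1).trans
    (congrArg (fyz • ·) ((c2.symm.trans b2).trans (congrArg (fxy • ·) (c3.trans b3)))))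
  have d' : (g * fxz) • 𝒢.mul ⟨(x, x', z'), hx, hxy'.trans hyz'⟩ τx σxz' =
      (fyz * (fxy * g')) • 𝒢.mul ⟨(x, x', z'), hx, hxy'.trans hyz'⟩ τx σxz' := by
    rw [mul_smul, mul_smul, mul_smul]
    exact d
  by_contra hcon
  have h0 : (g * fxz - fyz * (fxy * g')) •
      𝒢.mul ⟨(x, x', z'), hx, hxy'.trans hyz'⟩ τx σxz' = 0 := by rw [sub_smul, d', sub_self]
  rcases smul_eq_zero.1 h0 with h | h
  · exact hcon (sub_eq_zero.1 h)
  · exact hne h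

lemma norm_mul_one (𝒢 : BundleGerbe pr L) (q : FibreCube pr) (l : L q.pair₁₂) (m : L q.pair₂₃)
    (hl : 𝒢.metric.norm _ l = 1) (hm : 𝒢.metric.norm _ m = 1) :
    𝒢.metric.norm _ (𝒢.mul q l m) = 1 := by
  rw [𝒢.norm_mul, hl, hm, one_mul]

lemma cohomologyClass_eq_of_comparison [T2Space X] [ParacompactSpace X] (D D' : 𝒢.LocalData 𝒰)
    (τ : ∀ (x a : X) (hx : a ∈ 𝒰.set x), L ⟨(D.sec x ⟨a, hx⟩, D'.sec x ⟨a, hx⟩),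
      (D.proj_sec x ⟨a, hx⟩).trans (D'.proj_sec x ⟨a, hx⟩).symm⟩)
    (hτ : ∀ x, Continuous fun a : 𝒰.set x => TotalSpace.mk' ℂ (E := L) _ (τ x a a.2))
    (hn : ∀ x a hx, 𝒢.metric.norm _ (τ x a hx) = 1)
    (ν ν' : 𝒰.cocycles 3 ℤ)
    (hν : ∀ (i : Fin 4 → X) (a : 𝒰.inter i), (ν.1 i a : ℝ) = 𝒰.coboundary 2 ℝ D.phase i a)
    (hν' : ∀ (i : Fin 4 → X) (a : 𝒰.inter i), (ν'.1 i a : ℝ) = 𝒰.coboundary 2 ℝ D'.phase i a) :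
    𝒰.cohomologyClass ν = 𝒰.cohomologyClass ν' := by
  let lhs : ∀ (x y a : X) (hx : a ∈ 𝒰.set x) (hy : a ∈ 𝒰.set y), _ := fun x y a hx hy =>
    𝒢.mul ⟨(D.sec x ⟨a, hx⟩, D.sec y ⟨a, hy⟩, D'.sec y ⟨a, hy⟩),
      (D.proj_sec x ⟨a, hx⟩).trans (D.proj_sec y ⟨a, hy⟩).symm,
      (D.proj_sec y ⟨a, hy⟩).trans (D'.proj_sec y ⟨a, hy⟩).symm⟩ (D.triv x y a hx hy) (τ y a hy)
  let rhs : ∀ (x y a : X) (hx : a ∈ 𝒰.set x) (hy : a ∈ 𝒰.set y), _ := fun x y a hx hy =>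
    𝒢.mul ⟨(D.sec x ⟨a, hx⟩, D'.sec x ⟨a, hx⟩, D'.sec y ⟨a, hy⟩),
      (D.proj_sec x ⟨a, hx⟩).trans (D'.proj_sec x ⟨a, hx⟩).symm,
      (D'.proj_sec x ⟨a, hx⟩).trans (D'.proj_sec y ⟨a, hy⟩).symm⟩ (τ x a hx) (D'.triv x y a hx hy)
  have nl : ∀ x y a hx hy, 𝒢.metric.norm _ (lhs x y a hx hy) = 1 := fun x y a hx hy =>
    𝒢.norm_mul_one _ _ _ (D.norm_triv _ _ _ _ _) (hn _ _ _)
  have nr : ∀ x y a hx hy, 𝒢.metric.norm _ (rhs x y a hx hy) = 1 := fun x y a hx hy =>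
    𝒢.norm_mul_one _ _ _ (hn _ _ _) (D'.norm_triv _ _ _ _ _)
  have rne : ∀ x y a hx hy, rhs x y a hx hy ≠ 0 := fun x y a hx hy =>
    𝒢.metric.ne_zero (nr x y a hx hy)
  choose f hf using fun (i : Fin 3 → X) (a : 𝒰.inter (p := 2) i) => LineBundle.exists_eq_smul _
    (lhs (i 0) (i 1) a (a.2 0) (a.2 1)) _ (rne (i 0) (i 1) a (a.2 0) (a.2 1))
  have hτi : ∀ (i : Fin 3 → X) (j : Fin 3), Continuous fun a : 𝒰.inter (p := 2) i =>
      TotalSpace.mk' ℂ (E := L) _ (τ (i j) a (a.2 j)) := fun i j =>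
    (hτ (i j)).comp (f := fun a : 𝒰.inter (p := 2) i => (⟨a.1, a.2 j⟩ : 𝒰.set (i j)))
      (by fun_prop)
  have fc : ∀ i, Continuous (f i) := by
    intro i
    refine LineBundle.continuous_of_smul (L := L)
      (fun a : 𝒰.inter (p := 2) i => ⟨(D.sec (i 0) ⟨a, a.2 0⟩, D'.sec (i 1) ⟨a, a.2 1⟩), _⟩)
      _ _ _ (fun a => rne (i 0) (i 1) a (a.2 0) (a.2 1)) (hf i) ?_ ?_
    · exact 𝒢.continuous_mul_sections
        (fun a : 𝒰.inter (p := 2) i => D.sec (i 0) ⟨a, a.2 0⟩) (fun a => D.sec (i 1) ⟨a, a.2 1⟩)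
        (fun a => D'.sec (i 1) ⟨a, a.2 1⟩) (by fun_prop) (by fun_prop) (by fun_prop) _ _ _ _
        (D.continuous_triv_comp i 0 1) (hτi i 1)
    · exact 𝒢.continuous_mul_sections
        (fun a : 𝒰.inter (p := 2) i => D.sec (i 0) ⟨a, a.2 0⟩) (fun a => D'.sec (i 0) ⟨a, a.2 0⟩)
        (fun a => D'.sec (i 1) ⟨a, a.2 1⟩) (by fun_prop) (by fun_prop) (by fun_prop) _ _ _ _
        (hτi i 0) (D'.continuous_triv_comp i 0 1)
  have fn : ∀ i a, ‖f i a‖ = 1 := by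
    intro i a
    have h : (1 : ℝ) = ‖f i a‖ * 1 :=
      ((nl (i 0) (i 1) a (a.2 0) (a.2 1)).symm.trans
        (congrArg (𝒢.metric.norm _) (hf i a))).trans ((𝒢.metric.norm_smul _ _ _).trans
        (congrArg (‖f i a‖ * ·) (nr (i 0) (i 1) a (a.2 0) (a.2 1))))
    linarith
  obtain ⟨𝒱, r, hr, ρ, hρ⟩ := exists_phase (𝒰 := 𝒰) (fun i => ⟨f i, fc i⟩) fn
  let θ : 𝒱.Cochain 1 ℝ := fun i => (ρ ![i 0, i 1, i 0]).comp
    ⟨fun a => ⟨a.1, mem₃ (a.2 0) (a.2 1) (a.2 0)⟩, by fun_prop⟩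
  have hθ : ∀ (x y a : X) (hx : a ∈ 𝒱.set x) (hy : a ∈ 𝒱.set y),
      lhs (r x) (r y) a (hr _ hx) (hr _ hy) =
      Complex.exp (2 * Real.pi * Complex.I * eval θ ![x, y] a) •
        rhs (r x) (r y) a (hr _ hx) (hr _ hy) := by
    intro x y a hx hy
    rw [eval_of_mem _ _ _ (mem₂ hx hy)]
    have h1 := hρ ![x, y, x] ⟨a, mem₃ hx hy hx⟩
    have h2 := hf (r ∘ ![x, y, x]) ⟨a, fun j => hr _ (mem₃ hx hy hx j)⟩
    exact h2.trans (congrArg (· • rhs (r x) (r y) a (hr _ hx) (hr _ hy)) h1)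
  let E := D.pullback r hr
  let E' := D'.pullback r hr
  obtain ⟨k, hk⟩ := exists_int (E.phase - E'.phase - 𝒱.coboundary 1 ℝ θ) (by
    rintro i ⟨a, ha⟩
    have key := 𝒢.coeff_comparison _ _ _ _ _ _ _ _ _ _ _ _ _ _ _ _ _ _ _ _ _
      (rne (r (i 0)) (r (i 2)) a (hr _ (ha 0)) (hr _ (ha 2)))
      (E.mulTriv_eq (i 0) (i 1) (i 2) a (ha 0) (ha 1) (ha 2))
      (E'.mulTriv_eq (i 0) (i 1) (i 2) a (ha 0) (ha 1) (ha 2))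
      (hθ (i 0) (i 1) a (ha 0) (ha 1)) (hθ (i 1) (i 2) a (ha 1) (ha 2))
      (hθ (i 0) (i 2) a (ha 0) (ha 2))
    simp only [← Complex.exp_add] at key
    have hi : ![i 0, i 1, i 2] = i := by ext j; fin_cases j <;> rfl
    have h1 := coboundary_one θ i a ha
    rw [eval_of_mem _ _ _ ha] at h1
    rw [hi, eval_of_mem _ _ _ ha, eval_of_mem _ _ _ ha] at key
    change Complex.exp (2 * Real.pi * Complex.I *
      ((E.phase i ⟨a, ha⟩ - E'.phase i ⟨a, ha⟩ - 𝒱.coboundary 1 ℝ θ i ⟨a, ha⟩ : ℝ) : ℂ)) = 1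
    rw [h1]
    push_cast
    rw [show (2 * Real.pi * Complex.I : ℂ) * (E.phase i ⟨a, ha⟩ - E'.phase i ⟨a, ha⟩ -
        (eval θ ![i 1, i 2] a - eval θ ![i 0, i 2] a + eval θ ![i 0, i 1] a)) =
        (2 * Real.pi * Complex.I * E.phase i ⟨a, ha⟩ +
          2 * Real.pi * Complex.I * eval θ ![i 0, i 2] a) -
        (2 * Real.pi * Complex.I * eval θ ![i 1, i 2] a +
          (2 * Real.pi * Complex.I * eval θ ![i 0, i 1] a +
          2 * Real.pi * Complex.I * E'.phase i ⟨a, ha⟩)) by ring,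
      Complex.exp_sub, key, div_self (Complex.exp_ne_zero _)])
  rw [← cohomologyClass_pull r hr ν, ← cohomologyClass_pull r hr ν']
  refine cohomologyClass_eq k ?_
  ext i a
  apply Int.cast_injective (α := ℝ)
  have h1 := coboundary_intCast k _ hk i a
  rw [h1, map_sub, map_sub, coboundary_coboundary_one, sub_zero]
  have h2 := hν (r ∘ i) ⟨a.1, fun j => hr _ (a.2 j)⟩
  have h3 := hν' (r ∘ i) ⟨a.1, fun j => hr _ (a.2 j)⟩
  change ((ν.1 (r ∘ i) ⟨a.1, _⟩ - ν'.1 (r ∘ i) ⟨a.1, _⟩ : ℤ) : ℝ) =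
    𝒱.coboundary 2 ℝ (pull r hr D.phase) i a - 𝒱.coboundary 2 ℝ (pull r hr D'.phase) i a
  rw [coboundary_pull, coboundary_pull, Int.cast_sub, h2, h3]
  rfl

theorem IsDixmierDouadyClass.unique [T2Space X] [ParacompactSpace X] {d d' : CechCohomology X 3 ℤ}
    (h : 𝒢.IsDixmierDouadyClass d) (h' : 𝒢.IsDixmierDouadyClass d') : d = d' := by
  obtain ⟨𝒰, D, ν, hν, rfl⟩ := h
  obtain ⟨𝒰', D', ν', hν', rfl⟩ := h'
  obtain ⟨𝒲, hW, hW'⟩ := exists_ge_ge 𝒰 𝒰'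
  obtain ⟨𝒱, hV, τ, hτ, hn⟩ := exists_comparison
    (D.pullback id hW).toLocalSections (D'.pullback id hW').toLocalSections
  have k1 : ∀ a, 𝒱.set a ⊆ 𝒰.set (id a) := fun a => (hV a).trans (hW a)
  have k2 : ∀ a, 𝒱.set a ⊆ 𝒰'.set (id a) := fun a => (hV a).trans (hW' a)
  rw [← cohomologyClass_pull id k1 ν, ← cohomologyClass_pull id k2 ν']
  refine cohomologyClass_eq_of_comparison (D.pullback id k1) (D'.pullback id k2) τ hτ hn _ _ ?_ ?_
  · intro i a
    change _ = 𝒱.coboundary 2 ℝ (pull id k1 D.phase) i a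
    rw [coboundary_pull]
    exact hν (id ∘ i) ⟨a.1, fun j => k1 _ (a.2 j)⟩
  · intro i a
    change _ = 𝒱.coboundary 2 ℝ (pull id k2 D'.phase) i a
    rw [coboundary_pull]
    exact hν' (id ∘ i) ⟨a.1, fun j => k2 _ (a.2 j)⟩

/-- The Dixmier–Douady class `d(L) ∈ H³(X, ℤ)` of a bundle gerbe. -/
noncomputable def dixmierDouadyClass [T2Space X] [ParacompactSpace X] (𝒢 : BundleGerbe pr L) :
    CechCohomology X 3 ℤ := 𝒢.exists_isDixmierDouadyClass.choose

lemma isDixmierDouadyClass_iff [T2Space X] [ParacompactSpace X] (𝒢 : BundleGerbe pr L)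
    (d : CechCohomology X 3 ℤ) : 𝒢.IsDixmierDouadyClass d ↔ d = 𝒢.dixmierDouadyClass :=
  ⟨fun h => h.unique 𝒢.exists_isDixmierDouadyClass.choose_spec,
    fun h => h ▸ 𝒢.exists_isDixmierDouadyClass.choose_spec⟩

end BundleGerbe

end Existence

/-!
Over a cover fine enough to carry sections `s_x` of `pr`, unit sections `σ_xy` of `(s_x, s_y)⁻¹ L`
and trivializations of the bundles `s_x⁻¹ E`, the action of `σ_xy` on the module is a continuous
family of invertible `n × n` matrices `A_xy`. Compatibility of the action with the product of the
gerbe says that `A_xy A_yz = g_xyz A_xz`, where `g = exp (2π i ρ)` is the cocycle that measures the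
failure of `σ_xy ⊗ σ_yz` to be `σ_xz`. Taking determinants,
`det A_xy · det A_yz = g_xyz ^ n · det A_xz`, so that `g ^ n` is the coboundary of the `U(1)`-valued
cochain `det A / |det A|`.

After a further refinement this cochain has a logarithm `exp (2π i θ)`, and then
`n ρ - δθ` takes integral values. Its coboundary is `n δρ`, an `n`-fold multiple of a cocycle
representing the Dixmier–Douady class, which therefore vanishes in cohomology.

The determinants are studied in `BundleGerbeModule.det_localAct_ne_zero`,
`BundleGerbeModule.det_localAct_mul` and `BundleGerbeModule.continuous_det_localAct`; the
cohomological argument is `BundleGerbe.LocalData.smul_cohomologyClass_eq_zero`.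
-/

/-! ### Logarithms of 1-cochains -/

namespace PointedCover

variable {X : Type u} [TopologicalSpace X] {𝒰 : PointedCover X}

lemma exists_phase_one [T2Space X] [ParacompactSpace X] (f : 𝒰.Cochain 1 ℂ)
    (hf : ∀ i a, ‖f i a‖ = 1) : ∃ (𝒱 : PointedCover X) (r : X → X)
      (h : ∀ a, 𝒱.set a ⊆ 𝒰.set (r a)) (θ : 𝒱.Cochain 1 ℝ),
      ∀ (x y a : X) (hx : a ∈ 𝒱.set x) (hy : a ∈ 𝒱.set y),
        f ![r x, r y] ⟨a, mem₂ (h x hx) (h y hy)⟩ =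
          Complex.exp (2 * Real.pi * Complex.I * eval θ ![x, y] a) := by
  -- `f` is regarded as a 2-cochain that ignores its last index.
  obtain ⟨𝒱, r, hr, ρ, hρ⟩ := BundleGerbe.exists_phase (𝒰 := 𝒰)
    (fun i => (f ![i 0, i 1]).comp ⟨fun a => ⟨a.1, mem₂ (a.2 0) (a.2 1)⟩, by fun_prop⟩)
    (fun i a => hf _ _)
  refine ⟨𝒱, r, hr, fun i => (ρ ![i 0, i 1, i 0]).comp
    ⟨fun a => ⟨a.1, mem₃ (a.2 0) (a.2 1) (a.2 0)⟩, by fun_prop⟩, fun x y a hx hy => ?_⟩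
  rw [eval_of_mem _ _ _ (mem₂ hx hy)]
  exact hρ ![x, y, x] ⟨a, mem₃ hx hy hx⟩

end PointedCover

/-! ### The action of the gerbe in local trivializations of the module -/

namespace BundleGerbeModule

variable {X : Type u} {Y : Type v} [TopologicalSpace X] [TopologicalSpace Y]
  {pr : Y → X} {L : FibreSquare pr → Type w}
  [∀ q, AddCommGroup (L q)] [∀ q, Module ℂ (L q)] [∀ q, TopologicalSpace (L q)]
  [TopologicalSpace (TotalSpace ℂ L)] [FiberBundle ℂ L] [VectorBundle ℂ ℂ L]
  {𝒢 : BundleGerbe pr L} {n : ℕ} {E : Y → Type*}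
  [∀ y, AddCommGroup (E y)] [∀ y, Module ℂ (E y)] [∀ y, TopologicalSpace (E y)]
  [TopologicalSpace (TotalSpace (EuclideanSpace ℂ (Fin n)) E)]
  [FiberBundle (EuclideanSpace ℂ (Fin n)) E] [VectorBundle ℂ (EuclideanSpace ℂ (Fin n)) E]

lemma continuous_act_sections (M : BundleGerbeModule 𝒢 n E) {T : Type*} [TopologicalSpace T]
    (q : T → FibreSquare pr) (hq : Continuous q) (l : ∀ t, L (q t)) (v : ∀ t, E (q t).1.2)
    (hl : Continuous fun t => TotalSpace.mk' ℂ (E := L) _ (l t))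
    (hv : Continuous fun t => TotalSpace.mk' (EuclideanSpace ℂ (Fin n)) (E := E) _ (v t)) :
    Continuous fun t => TotalSpace.mk' (EuclideanSpace ℂ (Fin n)) (E := E) _
      (M.act (q t) (l t) (v t)) := by
  have hsnd : Continuous fun q : FibreSquare pr => q.1.2 := by fun_prop
  have key : Continuous fun t => (TotalSpace.mk' (ℂ × EuclideanSpace ℂ (Fin n))
      (E := L ×ᵇ ((fun q : FibreSquare pr => q.1.2) *ᵖ E)) (q t) (l t, v t)) := by
    rw [(FiberBundle.Prod.isInducing_diag ℂ _ (EuclideanSpace ℂ (Fin n)) _).continuous_iff]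
    refine Continuous.prodMk hl ?_
    rw [(inducing_pullbackTotalSpaceEmbedding (EuclideanSpace ℂ (Fin n)) E _).continuous_iff]
    exact hq.prodMk hv
  exact M.continuous_act.comp key

lemma surjective_act (M : BundleGerbeModule 𝒢 n E) (q : FibreSquare pr) (l : L q) (hl : l ≠ 0) :
    Function.Surjective (M.act q l) := by
  intro w
  obtain ⟨t, rfl⟩ := (M.bijective_act q).2 w
  induction t with
  | zero => exact ⟨0, by simp⟩
  | tmul m v =>
    obtain ⟨c, rfl⟩ := LineBundle.exists_eq_smul q m l hl
    exact ⟨c • v, by simp⟩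
  | add s t hs ht =>
    obtain ⟨v, hv⟩ := hs
    obtain ⟨v', hv'⟩ := ht
    exact ⟨v + v', by rw [map_add, map_add, hv, hv']⟩

variable (e e' e'' : Trivialization (EuclideanSpace ℂ (Fin n))
    (TotalSpace.proj : TotalSpace (EuclideanSpace ℂ (Fin n)) E → Y))
  [MemTrivializationAtlas e] [MemTrivializationAtlas e'] [MemTrivializationAtlas e'']

/-- The action `E_(y₂) → E_(y₁)` of an element of `L_(y₁,y₂)`, as an endomorphism of `ℂⁿ` by means
of trivializations of `E` at `y₁` and `y₂`. -/
noncomputable def localAct (M : BundleGerbeModule 𝒢 n E) (q : FibreSquare pr) (h : q.1.1 ∈ e.baseSet)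
    (h' : q.1.2 ∈ e'.baseSet) (l : L q) :
    EuclideanSpace ℂ (Fin n) →ₗ[ℂ] EuclideanSpace ℂ (Fin n) :=
  (e.continuousLinearEquivAt ℂ q.1.1 h).toLinearEquiv.toLinearMap ∘ₗ M.act q l ∘ₗ
    (e'.continuousLinearEquivAt ℂ q.1.2 h').symm.toLinearEquiv.toLinearMap

variable {e e' e''}

lemma det_localAct_ne_zero (M : BundleGerbeModule 𝒢 n E) (q : FibreSquare pr)
    (h : q.1.1 ∈ e.baseSet) (h' : q.1.2 ∈ e'.baseSet) (l : L q) (hl : l ≠ 0) :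
    (M.localAct e e' q h h' l).det ≠ 0 := by
  have hs : Function.Surjective (M.localAct e e' q h h' l) :=
    (e.continuousLinearEquivAt ℂ q.1.1 h).surjective.comp ((M.surjective_act q l hl).comp
      (e'.continuousLinearEquivAt ℂ q.1.2 h').symm.surjective)
  have hu : IsUnit (M.localAct e e' q h h' l) :=
    (LinearMap.isUnit_iff_range_eq_top _).2 (LinearMap.range_eq_top.2 hs)
  exact ((LinearMap.isUnit_iff_isUnit_det _).1 hu).ne_zero

lemma det_localAct_mul (M : BundleGerbeModule 𝒢 n E) {y₁ y₂ y₃ : Y} (h₁₂ : pr y₁ = pr y₂)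
    (h₂₃ : pr y₂ = pr y₃) (h₁ : y₁ ∈ e.baseSet) (h₂ : y₂ ∈ e'.baseSet) (h₃ : y₃ ∈ e''.baseSet)
    (k : L ⟨(y₁, y₂), h₁₂⟩) (l : L ⟨(y₂, y₃), h₂₃⟩) (m : L ⟨(y₁, y₃), h₁₂.trans h₂₃⟩) (c : ℂ)
    (hc : 𝒢.mul ⟨(y₁, y₂, y₃), h₁₂, h₂₃⟩ k l = c • m) :
    (M.localAct e e' _ h₁ h₂ k).det * (M.localAct e' e'' _ h₂ h₃ l).det =
      c ^ n * (M.localAct e e'' _ h₁ h₃ m).det := by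
  have key : M.localAct e e' _ h₁ h₂ k * M.localAct e' e'' _ h₂ h₃ l =
      c • M.localAct e e'' _ h₁ h₃ m := by
    ext1 v
    have h := M.mul_act y₁ y₂ y₃ h₁₂ h₂₃ k l ((e''.continuousLinearEquivAt ℂ y₃ h₃).symm v)
    have h' : M.act ⟨(y₁, y₃), h₁₂.trans h₂₃⟩ (𝒢.mul ⟨(y₁, y₂, y₃), h₁₂, h₂₃⟩ k l) =
        c • M.act ⟨(y₁, y₃), h₁₂.trans h₂₃⟩ m :=
      (congrArg (M.act ⟨(y₁, y₃), h₁₂.trans h₂₃⟩) hc).trans (map_smul _ c m)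
    rw [h'] at h
    have h'' := congrArg (e.continuousLinearEquivAt ℂ y₁ h₁) h
    rw [LinearMap.smul_apply, map_smul] at h''
    refine Eq.trans ?_ h''.symm
    exact congrArg (fun w => e.continuousLinearEquivAt ℂ y₁ h₁ (M.act ⟨(y₁, y₂), h₁₂⟩ k w))
      ((e'.continuousLinearEquivAt ℂ y₂ h₂).symm_apply_apply _)
  rw [← map_mul, key, LinearMap.det_smul, finrank_euclideanSpace_fin]

lemma continuous_det_localAct (M : BundleGerbeModule 𝒢 n E) {T : Type*} [TopologicalSpace T]
    (q : T → FibreSquare pr) (hq : Continuous q) (h : ∀ t, (q t).1.1 ∈ e.baseSet)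
    (h' : ∀ t, (q t).1.2 ∈ e'.baseSet) (l : ∀ t, L (q t))
    (hl : Continuous fun t => TotalSpace.mk' ℂ (E := L) _ (l t)) :
    Continuous fun t => (M.localAct e e' (q t) (h t) (h' t) (l t)).det := by
  have hv : ∀ v, Continuous fun t => M.localAct e e' (q t) (h t) (h' t) (l t) v := by
    intro v
    have h1 : Continuous fun t => TotalSpace.mk' (EuclideanSpace ℂ (Fin n)) (E := E) _
        ((e'.continuousLinearEquivAt ℂ (q t).1.2 (h' t)).symm v) := by
      have h2 : Continuous fun t => e'.toOpenPartialHomeomorph.symm ((q t).1.2, v) :=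
        e'.toOpenPartialHomeomorph.continuousOn_symm.comp_continuous (by fun_prop)
          fun t => by rw [e'.target_eq]; exact ⟨h' t, Set.mem_univ _⟩
      exact h2.congr fun t => (e'.mk_symm (h' t) v).symm
    exact continuous_snd.comp (e.continuousOn.comp_continuous
      (M.continuous_act_sections q hq l _ hl h1) fun t => e.mem_source.2 (h t))
  let b := EuclideanSpace.basisFun (Fin n) ℂ
  have hb : ∀ t, (M.localAct e e' (q t) (h t) (h' t) (l t)).det =
      (LinearMap.toMatrix b.toBasis b.toBasis
        (M.localAct e e' (q t) (h t) (h' t) (l t))).det := fun t =>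
    (LinearMap.det_toMatrix _ _).symm
  simp only [hb]
  refine Continuous.matrix_det (continuous_matrix fun i j => ?_)
  simp only [LinearMap.toMatrix_apply]
  exact ((EuclideanSpace.proj i : _ →L[ℂ] ℂ).continuous.comp (hv (b.toBasis j))).congr
    fun t => by simp [b]

end BundleGerbeModule

/-! ### The determinant trivializes the `n`-th power of the gerbe cocycle -/

namespace BundleGerbe

open PointedCover

variable {X : Type u} {Y : Type v} [TopologicalSpace X] [TopologicalSpace Y]
  {pr : Y → X} {L : FibreSquare pr → Type w}
  [∀ q, AddCommGroup (L q)] [∀ q, Module ℂ (L q)] [∀ q, TopologicalSpace (L q)]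
  [TopologicalSpace (TotalSpace ℂ L)] [FiberBundle ℂ L] [VectorBundle ℂ ℂ L]
  {𝒢 : BundleGerbe pr L} {𝒰 : PointedCover X} {n : ℕ} {E : Y → Type*}
  [∀ y, AddCommGroup (E y)] [∀ y, Module ℂ (E y)] [∀ y, TopologicalSpace (E y)]
  [TopologicalSpace (TotalSpace (EuclideanSpace ℂ (Fin n)) E)]
  [FiberBundle (EuclideanSpace ℂ (Fin n)) E] [VectorBundle ℂ (EuclideanSpace ℂ (Fin n)) E]

/-- If the module is trivial along the local sections, then the `n`-th power of the cocycle
`exp (2π i ρ)` is the coboundary of a `U(1)`-valued cochain, the normalized determinant of the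
action. -/
lemma LocalData.exists_unit_cochain (D : 𝒢.LocalData 𝒰) (M : BundleGerbeModule 𝒢 n E) (y : X → Y)
    (hy : ∀ x a, D.sec x a ∈ (trivializationAt (EuclideanSpace ℂ (Fin n)) E (y x)).baseSet) :
    ∃ f : 𝒰.Cochain 1 ℂ, (∀ i a, ‖f i a‖ = 1) ∧
      ∀ (x y z a : X) (hx : a ∈ 𝒰.set x) (hy : a ∈ 𝒰.set y) (hz : a ∈ 𝒰.set z),
        f ![x, y] ⟨a, mem₂ hx hy⟩ * f ![y, z] ⟨a, mem₂ hy hz⟩ =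
          Complex.exp (2 * Real.pi * Complex.I * eval D.phase ![x, y, z] a) ^ n *
            f ![x, z] ⟨a, mem₂ hx hz⟩ := by
  let d : ∀ (x z a : X) (hx : a ∈ 𝒰.set x) (hz : a ∈ 𝒰.set z), ℂ := fun x z a hx hz =>
    (M.localAct (trivializationAt _ E (y x)) (trivializationAt _ E (y z)) _
      (hy x ⟨a, hx⟩) (hy z ⟨a, hz⟩) (D.triv x z a hx hz)).det
  have d0 : ∀ x z a hx hz, d x z a hx hz ≠ 0 := fun x z a hx hz =>
    M.det_localAct_ne_zero _ _ _ _ (D.triv_ne_zero x z a hx hz)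
  have dc : ∀ i : Fin 2 → X, Continuous fun a : 𝒰.inter (p := 1) i =>
      d (i 0) (i 1) a (a.2 0) (a.2 1) := fun i =>
    M.continuous_det_localAct (fun a : 𝒰.inter (p := 1) i =>
      (⟨(D.sec (i 0) ⟨a, a.2 0⟩, D.sec (i 1) ⟨a, a.2 1⟩), _⟩ : FibreSquare pr)) (by fun_prop)
      _ _ _ (D.continuous_triv_comp i 0 1)
  have dm : ∀ (x y z a : X) (hx : a ∈ 𝒰.set x) (hy : a ∈ 𝒰.set y) (hz : a ∈ 𝒰.set z),
      d x y a hx hy * d y z a hy hz =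
        Complex.exp (2 * Real.pi * Complex.I * eval D.phase ![x, y, z] a) ^ n *
          d x z a hx hz := fun x y z a hx hy hz =>
    M.det_localAct_mul _ _ _ _ _ _ _ _ _ (D.mulTriv_eq x y z a hx hy hz)
  refine ⟨fun i => ⟨fun a => d (i 0) (i 1) a (a.2 0) (a.2 1) /
    (‖d (i 0) (i 1) a (a.2 0) (a.2 1)‖ : ℂ), ?_⟩, fun i a => ?_, fun x y z a hx hy hz => ?_⟩
  · exact (dc i).div (Complex.continuous_ofReal.comp (dc i).norm) fun a => by
      simpa using d0 (i 0) (i 1) a (a.2 0) (a.2 1)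
  · simpa using div_self (norm_ne_zero_iff.2 (d0 (i 0) (i 1) a (a.2 0) (a.2 1)))
  · have hn := congrArg norm (dm x y z a hx hy hz)
    have he : ‖Complex.exp (2 * Real.pi * Complex.I * eval D.phase ![x, y, z] a)‖ = 1 := by
      simp [Complex.norm_exp]
    rw [_root_.norm_mul, _root_.norm_mul, norm_pow, he, one_pow, one_mul] at hn
    change d x y a hx hy / (‖d x y a hx hy‖ : ℂ) * (d y z a hy hz / (‖d y z a hy hz‖ : ℂ)) =
      _ * (d x z a hx hz / (‖d x z a hx hz‖ : ℂ))
    rw [div_mul_div_comm, dm, ← hn, Complex.ofReal_mul, mul_div_assoc]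

/-- A `U(1)`-valued cochain whose coboundary is `exp (2π i ρ) ^ n` makes the class of `n δρ`
vanish. -/
lemma LocalData.smul_cohomologyClass_eq_zero [T2Space X] [ParacompactSpace X]
    (D : 𝒢.LocalData 𝒰) (n : ℕ) (f : 𝒰.Cochain 1 ℂ) (hf : ∀ i a, ‖f i a‖ = 1)
    (hmul : ∀ (x y z a : X) (hx : a ∈ 𝒰.set x) (hy : a ∈ 𝒰.set y) (hz : a ∈ 𝒰.set z),
      f ![x, y] ⟨a, mem₂ hx hy⟩ * f ![y, z] ⟨a, mem₂ hy hz⟩ =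
        Complex.exp (2 * Real.pi * Complex.I * eval D.phase ![x, y, z] a) ^ n *
          f ![x, z] ⟨a, mem₂ hx hz⟩)
    (ν : 𝒰.cocycles 3 ℤ)
    (hν : ∀ (i : Fin 4 → X) (a : 𝒰.inter i), (ν.1 i a : ℝ) = 𝒰.coboundary 2 ℝ D.phase i a) :
    n • 𝒰.cohomologyClass ν = 0 := by
  obtain ⟨𝒱, r, hr, θ, hθ⟩ := exists_phase_one f hf
  obtain ⟨k, hk⟩ := exists_int (n • pull r hr D.phase - 𝒱.coboundary 1 ℝ θ) (by
    rintro i ⟨a, ha⟩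
    have key := hmul (r (i 0)) (r (i 1)) (r (i 2)) a (hr _ (ha 0)) (hr _ (ha 1)) (hr _ (ha 2))
    rw [hθ _ _ _ (ha 0) (ha 1), hθ _ _ _ (ha 1) (ha 2), hθ _ _ _ (ha 0) (ha 2),
      ← Complex.exp_nat_mul, ← Complex.exp_add, ← Complex.exp_add] at key
    have hi : r ∘ i = ![r (i 0), r (i 1), r (i 2)] := by ext j; fin_cases j <;> rfl
    have h1 := coboundary_one θ i a ha
    have h2 := eval_pull r hr D.phase i a ha
    rw [eval_of_mem _ _ _ ha] at h1 h2
    rw [hi] at h2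
    change Complex.exp (2 * Real.pi * Complex.I *
      ((n • pull r hr D.phase i ⟨a, ha⟩ - 𝒱.coboundary 1 ℝ θ i ⟨a, ha⟩ : ℝ) : ℂ)) = 1
    rw [h1, h2, nsmul_eq_mul]
    push_cast
    rw [show (2 * Real.pi * Complex.I : ℂ) * (n * eval D.phase ![r (i 0), r (i 1), r (i 2)] a -
        (eval θ ![i 1, i 2] a - eval θ ![i 0, i 2] a + eval θ ![i 0, i 1] a)) =
        (n * (2 * Real.pi * Complex.I * eval D.phase ![r (i 0), r (i 1), r (i 2)] a) +
          2 * Real.pi * Complex.I * eval θ ![i 0, i 2] a) -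
        (2 * Real.pi * Complex.I * eval θ ![i 0, i 1] a +
          2 * Real.pi * Complex.I * eval θ ![i 1, i 2] a) by ring,
      Complex.exp_sub, key, div_self (Complex.exp_ne_zero _)])
  rw [← cohomologyClass_pull r hr ν, ← map_nsmul, ← map_zero 𝒱.cohomologyClass]
  refine cohomologyClass_eq k ?_
  ext i a
  apply Int.cast_injective (α := ℝ)
  rw [coboundary_intCast k _ hk i a, map_sub, map_nsmul, coboundary_coboundary_one, sub_zero,
    coboundary_pull]
  have h := hν (r ∘ i) ⟨a.1, fun j => hr _ (a.2 j)⟩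
  change ((n • ν.1 (r ∘ i) ⟨a.1, _⟩ - 0 : ℤ) : ℝ) =
    n • 𝒰.coboundary 2 ℝ D.phase (r ∘ i) ⟨a.1, fun j => hr _ (a.2 j)⟩
  rw [← h]
  simp

end BundleGerbe

theorem mainTheorem6 {X : Type*} {Y : Type*} [TopologicalSpace X] [T2Space X] [ParacompactSpace X]
    [TopologicalSpace Y] {pr : Y → X} {L : FibreSquare pr → Type*}
    [∀ q, AddCommGroup (L q)] [∀ q, Module ℂ (L q)] [∀ q, TopologicalSpace (L q)]
    [TopologicalSpace (TotalSpace ℂ L)] [FiberBundle ℂ L] [VectorBundle ℂ ℂ L]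
    (𝒢 : BundleGerbe pr L) (n : ℕ) (E : Y → Type*)
    [∀ y, AddCommGroup (E y)] [∀ y, Module ℂ (E y)] [∀ y, TopologicalSpace (E y)]
    [TopologicalSpace (TotalSpace (EuclideanSpace ℂ (Fin n)) E)]
    [FiberBundle (EuclideanSpace ℂ (Fin n)) E]
    [VectorBundle ℂ (EuclideanSpace ℂ (Fin n)) E]
    (M : BundleGerbeModule 𝒢 n E) :
    n • 𝒢.dixmierDouadyClass = 0 := by
  obtain ⟨𝒰, ⟨D⟩⟩ := 𝒢.exists_localData
  let y : X → Y := fun x => D.sec x ⟨x, 𝒰.mem_set x⟩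
  -- `U_x` is shrunk until `s_x` takes values in the domain of a trivialization of `E`.
  let 𝒱 : PointedCover X :=
    { set := fun x => Subtype.val ''
        (D.sec x ⁻¹' (trivializationAt (EuclideanSpace ℂ (Fin n)) E (y x)).baseSet)
      isOpen_set := fun x => (𝒰.isOpen_set x).isOpenMap_subtype_val _
        ((trivializationAt (EuclideanSpace ℂ (Fin n)) E (y x)).open_baseSet.preimage
          (D.sec x).continuous)
      mem_set := fun x => ⟨⟨x, 𝒰.mem_set x⟩, FiberBundle.mem_baseSet_trivializationAt _ E _, rfl⟩ }
  have hr : ∀ a, 𝒱.set a ⊆ 𝒰.set (id a) := by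
    rintro a _ ⟨b, -, rfl⟩
    exact b.2
  obtain ⟨f, hf, hmul⟩ := (D.pullback id hr).exists_unit_cochain M y (by
    rintro x ⟨_, ⟨b, hb, rfl⟩⟩
    exact hb)
  obtain ⟨ν, hν⟩ := (D.pullback id hr).exists_cocycle
  rw [← (𝒢.isDixmierDouadyClass_iff _).1 ⟨𝒱, D.pullback id hr, ν, hν, rfl⟩]
  exact (D.pullback id hr).smul_cohomologyClass_eq_zero n f hf hmul ν hν
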